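/- Consider real solutions $y$ of the first Painlev\'e equation $y''=6y^2-x$, each taken on its interval of existence $(a,b)$, the maximal open real interval on which it is defined. For $x_0\le 0$ define the following infima, with values a priori in $[-\infty,+\infty]$: - $X(x_0)$ is the infimum of the left endpoints $a$ of the intervals of existence of all solutions regular at $x_0$ (that is, with $x_0\in(a,b)$); - $X_-(x_0)$ is the infimum of $a$ over those solutions regular at $x_0$ with $y'(x_0)\le 0$; - $X_{min}(x_0)$ is the infimum of the points $x_{min}<x_0$ at which a solution regular at $x_0$ with $y'(x_0)\ge 0$ attains its minimum on $(a,x_0]$. Let $$C=\max_{v<0}\int_0^{+\infty}\frac{dw}{\sqrt{w^4+3vw^2+3v^2+1/2}},$$ and for $x_0\le0$ let $\eta(x_0)$ be the unique positive root of $\eta^5-|x_0|\eta=C$. (The maximum exists, and so does the unique positive root.) Then for every $x_0\le 0$ the values $X_{min}(x_0)$, $X_-(x_0)$ and $X(x_0)$ are finite, and $$X_-(X_{min}(x_0))\le X(x_0)<x_0-\frac{2^{4/5}C}{\eta(x_0/2^{4/5})}.$$ Moreover, for every $x_0<0$, $$x_0-\frac{C}{|x_0|^{1/4}}-\frac{C}{\eta(x_0)}<X_{min}(x_0)-\frac{C}{|X_{min}(x_0)|^{1/4}}<X(x_0)<x_0-\frac{2^{4/5}C}{|X_{min}(x_0/2^{4/5})|^{1/4}}<x_0-\frac{2C}{\big||x_0|+2C/|x_0|^{1/4}\big|^{1/4}}.$$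 In particular, as $x_0\to-\infty$, $$X(x_0)=x_0-\frac{2C}{|x_0|^{1/4}}+\mathcal O\big(|x_0|^{-3/2}\big),$$ and for $x_0\le 0$ with $|x_0|>(2C)^{4/5}$ the error term satisfies $$0<X(x_0)-x_0+\frac{2C}{|x_0|^{1/4}}<\frac{C^2}{|x_0|^{3/2}}.$$ -/

import Mathlib

namespace PainleveOne

/-- `y` solves `y'' = 6 y ^ 2 - x` at every point of the set `I`. -/
def SolvesOn (y : ℝ → ℝ) (I : Set ℝ) : Prop :=
  ∀ x ∈ I, DifferentiableAt ℝ y x ∧ HasDerivAt (deriv y) (6 * y x ^ 2 - x) x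

/-- `y` is a real solution with interval of existence `I`: `I` is an open interval on which `y`
solves the equation, and `y` has no extension to a solution on a larger open interval.
(Only the values of `y` on `I` matter.) -/
structure IsSolution (y : ℝ → ℝ) (I : Set ℝ) : Prop where
  isOpen : IsOpen I
  isPreconnected : IsPreconnected I
  solves : SolvesOn y I
  maximal : ∀ (z : ℝ → ℝ) (J : Set ℝ), IsOpen J → IsPreconnected J → SolvesOn z J → I ⊆ J →
    Set.EqOn z y I → J ⊆ I

/-- The left endpoint of an interval, possibly `-∞`. -/
noncomputable def leftEnd (I : Set ℝ) : EReal := ⨅ x ∈ I, (x : EReal)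

/-- Infimum of the left endpoints of the intervals of existence of all solutions regular at `x₀`,
with values in `[-∞, ∞]`. -/
noncomputable def extX (x₀ : ℝ) : EReal :=
  sInf {a | ∃ (y : ℝ → ℝ) (I : Set ℝ), IsSolution y I ∧ x₀ ∈ I ∧ a = leftEnd I}

/-- The same infimum, over the solutions with `y' x₀ ≤ 0` only. -/
noncomputable def extXminus (x₀ : ℝ) : EReal :=
  sInf {a | ∃ (y : ℝ → ℝ) (I : Set ℝ), IsSolution y I ∧ x₀ ∈ I ∧ deriv y x₀ ≤ 0 ∧ a = leftEnd I}

/-- Infimum of the points `m < x₀` at which some solution regular at `x₀`, with `0 ≤ y' x₀`,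
attains its minimum to the left of `x₀`. -/
noncomputable def extXmin (x₀ : ℝ) : EReal :=
  sInf {a | ∃ (y : ℝ → ℝ) (I : Set ℝ) (m : ℝ), IsSolution y I ∧ x₀ ∈ I ∧ 0 ≤ deriv y x₀ ∧
    m ∈ I ∧ m < x₀ ∧ IsMinOn y (I ∩ Set.Iic x₀) m ∧ a = (m : EReal)}

/-- Real values of the three infima (meaningful where the infima are finite). -/
noncomputable def X (x₀ : ℝ) : ℝ := (extX x₀).toReal

noncomputable def Xminus (x₀ : ℝ) : ℝ := (extXminus x₀).toReal

noncomputable def Xmin (x₀ : ℝ) : ℝ := (extXmin x₀).toReal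

/-- The integral `∫₀^∞ dw / √(w⁴ + 3 v w² + 3 v² + 1/2)`. -/
noncomputable def integralI (v : ℝ) : ℝ :=
  ∫ w in Set.Ioi (0 : ℝ), 1 / √(w ^ 4 + 3 * v * w ^ 2 + 3 * v ^ 2 + 1 / 2)

/-- The constant `C`, the maximum of `integralI` over `v < 0`. -/
noncomputable def C : ℝ := sSup (integralI '' Set.Iio 0)

/-- The positive roots of `η ^ 5 - |x₀| η = C`. -/
def etaRoots (x₀ : ℝ) : Set ℝ := {h | 0 < h ∧ h ^ 5 - |x₀| * h = C}

/-- The positive root of `η ^ 5 - |x₀| η = C`. -/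
noncomputable def eta (x₀ : ℝ) : ℝ := sSup (etaRoots x₀)

end PainleveOne

open scoped Asymptotics

namespace PainleveOne

open Set Filter Topology MeasureTheory

/-! ### Local theory and maximal solutions -/

/-! For x ≤ 0, a solution followed leftwards or rightwards from a base point is a motion u'' = 6u² +
k with k = -x ≥ 0. If k is a constant c > 0 and the motion starts at rest in v, then u'² = 4(u³ -
v³) + 2c(u - v), and s = √(u - v) satisfies s'² = `quartic v c s`. The motion therefore blows up
after the time `blowup v c`, and rescaling s by c^(1/4) shows that the longest such time over all v
is C/c^(1/4).

Lower bounds: for a nonnegative initial velocity, a coefficient above c shortens the life. Going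
left from x₀ with y'(x₀) ≤ 0 the coefficient starts at |x₀| and grows; going right from a critical
point m to x₀ it decreases to |x₀|. Either way the time available is less than C/|x₀|^(1/4). Passing
to an infimum would lose strictness, so `exists_lifetime_increasing` and
`exists_lifetime_decreasing` provide a margin ε independent of the solution, by compactness in v.
The bounds for the two restricted infima combine through `extXminus_le_extX`: a solution reaching
past `Xmin x₀` has no critical point further left, hence has nonpositive slope there.

Upper bounds: a solution released at rest in the optimal v, under coefficients below t, outlives the
time C/t^(1/4). It is released at -t for `extXmin_le`, and at -t + C/t^(1/4) for `extX_lt`, where it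
survives in both directions. The equation defining `eta` selects the t for which the right end is
x₀. The remaining inequalities are algebra in fourth roots. -/

/-- The autonomous vector field on phase space `(y, y', x)` that encodes the equation. -/
def phaseField (z : ℝ × ℝ × ℝ) : ℝ × ℝ × ℝ := (z.2.1, 6 * z.1 ^ 2 - z.2.2, 1)

theorem contDiff_phaseField : ContDiff ℝ 1 phaseField := by
  unfold phaseField
  fun_prop

theorem SolvesOn.hasDerivAt {y : ℝ → ℝ} {I : Set ℝ} (h : SolvesOn y I) {x : ℝ} (hx : x ∈ I) :
    HasDerivAt y (deriv y x) x := (h x hx).1.hasDerivAt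

theorem SolvesOn.hasDerivAt_deriv {y : ℝ → ℝ} {I : Set ℝ} (h : SolvesOn y I) {x : ℝ}
    (hx : x ∈ I) : HasDerivAt (deriv y) (6 * y x ^ 2 - x) x := (h x hx).2

theorem SolvesOn.mono {y : ℝ → ℝ} {I J : Set ℝ} (h : SolvesOn y I) (hJ : J ⊆ I) : SolvesOn y J :=
  fun x hx => h x (hJ hx)

theorem SolvesOn.hasDerivAt_phase {y : ℝ → ℝ} {I : Set ℝ} (h : SolvesOn y I) {x : ℝ}
    (hx : x ∈ I) :
    HasDerivAt (fun t => (y t, deriv y t, t)) (phaseField (y x, deriv y x, x)) x :=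
  (h.hasDerivAt hx).prodMk ((h.hasDerivAt_deriv hx).prodMk (hasDerivAt_id x))

theorem SolvesOn.of_eventuallyEq {y z : ℝ → ℝ} {I : Set ℝ} {x : ℝ} (h : SolvesOn y I)
    (hx : x ∈ I) (hz : z =ᶠ[𝓝 x] y) :
    DifferentiableAt ℝ z x ∧ HasDerivAt (deriv z) (6 * z x ^ 2 - x) x := by
  rw [hz.eq_of_nhds]
  exact ⟨(h x hx).1.congr_of_eventuallyEq hz, (h x hx).2.congr_of_eventuallyEq hz.deriv⟩

/-- An integral curve of `phaseField` projects to a solution. -/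
theorem solvesOn_of_phase {α : ℝ → ℝ × ℝ × ℝ} {a b τ p q : ℝ} (hτ : τ ∈ Ioo a b)
    (hα : ∀ t ∈ Ioo a b, HasDerivAt α (phaseField (α t)) t) (h0 : α τ = (p, q, τ)) :
    SolvesOn (fun t => (α t).1) (Ioo a b) ∧ ∀ t ∈ Ioo a b,
      α t = ((α t).1, deriv (fun t => (α t).1) t, t) := by
  have h1 : ∀ t ∈ Ioo a b, HasDerivAt (fun t => (α t).1) (α t).2.1 t := fun t ht =>
    (ContinuousLinearMap.fst ℝ ℝ (ℝ × ℝ)).hasFDerivAt.comp_hasDerivAt t (hα t ht)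
  have h2' : ∀ t ∈ Ioo a b, HasDerivAt (fun t => (α t).2) (phaseField (α t)).2 t := fun t ht =>
    (ContinuousLinearMap.snd ℝ ℝ (ℝ × ℝ)).hasFDerivAt.comp_hasDerivAt t (hα t ht)
  have h2 : ∀ t ∈ Ioo a b, HasDerivAt (fun t => (α t).2.1) (6 * (α t).1 ^ 2 - (α t).2.2) t :=
    fun t ht => (ContinuousLinearMap.fst ℝ ℝ ℝ).hasFDerivAt.comp_hasDerivAt t (h2' t ht)
  have h3 : ∀ t ∈ Ioo a b, HasDerivAt (fun t => (α t).2.2) 1 t :=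
    fun t ht => (ContinuousLinearMap.snd ℝ ℝ ℝ).hasFDerivAt.comp_hasDerivAt t (h2' t ht)
  have ht3 : ∀ t ∈ Ioo a b, (α t).2.2 = t := by
    intro t ht
    have hd : ∀ s ∈ Ioo a b, HasDerivAt (fun s => (α s).2.2 - s) 0 s := fun s hs => by
      simpa using (h3 s hs).fun_sub (hasDerivAt_id' s)
    have := isOpen_Ioo.is_const_of_deriv_eq_zero isPreconnected_Ioo
      (fun s hs => (hd s hs).differentiableAt.differentiableWithinAt)
      (fun s hs => (hd s hs).deriv) ht hτ
    simp only [h0] at this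
    linarith
  have hder : ∀ t ∈ Ioo a b, deriv (fun t => (α t).1) t = (α t).2.1 := fun t ht => (h1 t ht).deriv
  refine ⟨fun t ht => ⟨(h1 t ht).differentiableAt, ?_⟩, fun t ht => ?_⟩
  · have := h2 t ht
    rw [ht3 t ht] at this
    refine this.congr_of_eventuallyEq ?_
    filter_upwards [isOpen_Ioo.mem_nhds ht] with s hs using hder s hs
  · rw [hder t ht]
    exact Prod.ext rfl (Prod.ext rfl (ht3 t ht))

/-- Around every point of phase space, solutions exist for a uniform time. -/
theorem exists_uniform_local_solution (z₀ : ℝ × ℝ × ℝ) :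
    ∃ r > 0, ∃ ε > 0, ∀ p q τ : ℝ, (p, q, τ) ∈ Metric.closedBall z₀ r →
      ∃ w : ℝ → ℝ, SolvesOn w (Ioo (τ - ε) (τ + ε)) ∧ w τ = p ∧ deriv w τ = q := by
  obtain ⟨r, hr, ε, hε, H⟩ :=
    ContDiffAt.exists_forall_mem_closedBall_exists_eq_forall_mem_Ioo_hasDerivAt
      (contDiff_phaseField.contDiffAt (x := z₀)) 0
  refine ⟨r, hr, ε, hε, fun p q τ hz => ?_⟩
  obtain ⟨α, hα0, hα⟩ := H _ hz
  have hτ : τ ∈ Ioo (τ - ε) (τ + ε) := ⟨by linarith, by linarith⟩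
  have hβ : ∀ t ∈ Ioo (τ - ε) (τ + ε),
      HasDerivAt (fun t => α (t - τ)) (phaseField (α (t - τ))) t := by
    intro t ht
    exact (hα (t - τ) ⟨by linarith [ht.1], by linarith [ht.2]⟩).comp_sub_const t τ
  obtain ⟨h1, h2⟩ := solvesOn_of_phase hτ hβ (by simpa using hα0)
  refine ⟨_, h1, by simp [hα0], ?_⟩
  have := h2 τ hτ
  simp only [sub_self, hα0, Prod.mk.injEq] at this
  exact this.2.1.symm

theorem SolvesOn.eq_of_eq {y w : ℝ → ℝ} {I : Set ℝ} (hI : I.OrdConnected) (ho : IsOpen I)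
    (hy : SolvesOn y I) (hw : SolvesOn w I) {τ : ℝ} (hτ : τ ∈ I) (h0 : y τ = w τ)
    (h1 : deriv y τ = deriv w τ) : EqOn y w I := by
  intro x hx
  -- The margin δ puts τ and x inside an open interval with compact closure in `I`; on the compact
  -- phase curves over that closure the field has a single Lipschitz constant.
  obtain ⟨δ, hδ, hball⟩ : ∃ δ > 0, Icc (min τ x - δ) (max τ x + δ) ⊆ I := by
    have hmin : min τ x ∈ I := by rcases min_choice τ x with h | h <;> rw [h] <;> assumption
    have hmax : max τ x ∈ I := by rcases max_choice τ x with h | h <;> rw [h] <;> assumption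
    obtain ⟨d1, hd1, hb1⟩ := Metric.isOpen_iff.1 ho _ hmin
    obtain ⟨d2, hd2, hb2⟩ := Metric.isOpen_iff.1 ho _ hmax
    refine ⟨min d1 d2 / 2, by positivity, hI.out (hb1 ?_) (hb2 ?_)⟩
    · rw [Real.ball_eq_Ioo]
      have := min_le_left d1 d2
      have : 0 < min d1 d2 := by positivity
      constructor <;> linarith
    · rw [Real.ball_eq_Ioo]
      have := min_le_right d1 d2
      have : 0 < min d1 d2 := by positivity
      constructor <;> linarith
  set a := min τ x - δ
  set b := max τ x + δ
  have cy : ContinuousOn (fun t => (y t, deriv y t, t)) (Icc a b) := fun t ht =>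
    (hy.hasDerivAt_phase (hball ht)).continuousAt.continuousWithinAt
  have cw : ContinuousOn (fun t => (w t, deriv w t, t)) (Icc a b) := fun t ht =>
    (hw.hasDerivAt_phase (hball ht)).continuousAt.continuousWithinAt
  obtain ⟨K, hK⟩ := LocallyLipschitzOn.exists_lipschitzOnWith_of_compact
    ((isCompact_Icc.image_of_continuousOn cy).union (isCompact_Icc.image_of_continuousOn cw))
    (contDiff_phaseField.locallyLipschitz.locallyLipschitzOn)
  have hsub : Ioo a b ⊆ Icc a b := Ioo_subset_Icc_self
  have := ODE_solution_unique_of_mem_Ioo (v := fun _ => phaseField) (K := K)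
    (s := fun _ => (fun t => (y t, deriv y t, t)) '' Icc a b ∪
      (fun t => (w t, deriv w t, t)) '' Icc a b) (t₀ := τ) (a := a) (b := b)
    (fun _ _ => hK) ⟨by linarith [min_le_left τ x], by linarith [le_max_left τ x]⟩
    (fun t ht => ⟨hy.hasDerivAt_phase (hball (hsub ht)), Or.inl ⟨t, hsub ht, rfl⟩⟩)
    (fun t ht => ⟨hw.hasDerivAt_phase (hball (hsub ht)), Or.inr ⟨t, hsub ht, rfl⟩⟩)
    (by simp [h0, h1])
  have hpair := this (x := x) ⟨by linarith [min_le_right τ x], by linarith [le_max_right τ x]⟩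
  exact congrArg Prod.fst hpair

/-- Every solution on an open interval extends to a maximal one. -/
theorem SolvesOn.exists_isSolution {w : ℝ → ℝ} {J : Set ℝ} (hJo : IsOpen J)
    (hJc : IsPreconnected J) (hJ : J.Nonempty) (hw : SolvesOn w J) :
    ∃ (y : ℝ → ℝ) (I : Set ℝ), IsSolution y I ∧ J ⊆ I ∧ EqOn y w J := by
  classical
  let P := {a : (ℝ → ℝ) × Set ℝ //
    IsOpen a.2 ∧ IsPreconnected a.2 ∧ SolvesOn a.1 a.2 ∧ J ⊆ a.2 ∧ EqOn a.1 w J}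
  let r : P → P → Prop := fun a b => a.1.2 ⊆ b.1.2 ∧ EqOn b.1.1 a.1.1 a.1.2
  have : Nonempty P := ⟨⟨(w, J), hJo, hJc, hw, subset_rfl, fun _ _ => rfl⟩⟩
  obtain ⟨x₀, hx₀⟩ := hJ
  have hub : ∀ c : Set P, IsChain r c → c.Nonempty → ∃ ub, ∀ a ∈ c, r a ub := by
    intro c hc hne
    let U : Set ℝ := ⋃ a ∈ c, a.1.2
    -- Members of a chain agree on common domains, so any choice of member yields the same glued
    -- function.
    let z : ℝ → ℝ := fun x => if h : ∃ a ∈ c, x ∈ a.1.2 then h.choose.1.1 x else 0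
    have hz : ∀ a ∈ c, EqOn z a.1.1 a.1.2 := by
      intro a ha x hx
      have h : ∃ a ∈ c, x ∈ a.1.2 := ⟨a, ha, hx⟩
      have hzx : z x = h.choose.1.1 x := dif_pos h
      rw [hzx]
      obtain ⟨hb, hxb⟩ := h.choose_spec
      by_cases hab : a = h.choose
      · rw [← hab]
      rcases hc ha hb hab with h' | h'
      · exact h'.2 hx
      · exact (h'.2 hxb).symm
    have hUo : IsOpen U := isOpen_biUnion fun a _ => a.2.1
    refine ⟨⟨(z, U), hUo, ?_, ?_, ?_, ?_⟩, fun a ha =>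
      ⟨subset_biUnion_of_mem (u := fun a : P => a.1.2) ha, hz a ha⟩⟩
    · rw [show U = ⋃₀ ((fun a : P => a.1.2) '' c) from (sUnion_image _ _).symm]
      refine isPreconnected_sUnion x₀ _ ?_ ?_
      · rintro _ ⟨a, _, rfl⟩
        exact a.2.2.2.2.1 hx₀
      · rintro _ ⟨a, _, rfl⟩
        exact a.2.2.1
    · intro x hx
      obtain ⟨a, ha, hxa⟩ := mem_iUnion₂.1 hx
      exact a.2.2.2.1.of_eventuallyEq hxa
        (Filter.eventuallyEq_of_mem (a.2.1.mem_nhds hxa) (hz a ha))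
    · obtain ⟨a, ha⟩ := hne
      exact a.2.2.2.2.1.trans (subset_biUnion_of_mem (u := fun a : P => a.1.2) ha)
    · obtain ⟨a, ha⟩ := hne
      exact ((hz a ha).mono a.2.2.2.2.1).trans a.2.2.2.2.2
  obtain ⟨⟨⟨y, I⟩, ho, hc, hs, hJI, heq⟩, hm⟩ := exists_maximal_of_nonempty_chains_bounded hub
    (fun {a b c} hab hbc => ⟨hab.1.trans hbc.1, fun x hx => (hbc.2 (hab.1 hx)).trans (hab.2 hx)⟩)
  refine ⟨y, I, ⟨ho, hc, hs, fun z K hKo hKc hzK hIK hzy => ?_⟩, hJI, heq⟩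
  exact (hm ⟨(z, K), hKo, hKc, hzK, hJI.trans hIK, (hzy.mono hJI).trans heq⟩ ⟨hIK, hzy⟩).1

/-- Every initial condition is satisfied by a maximal solution. -/
theorem exists_isSolution (x p q : ℝ) :
    ∃ (y : ℝ → ℝ) (I : Set ℝ), IsSolution y I ∧ x ∈ I ∧ y x = p ∧ deriv y x = q := by
  obtain ⟨r, hr, ε, hε, H⟩ := exists_uniform_local_solution (p, q, x)
  obtain ⟨w, hw, hp, hq⟩ := H p q x (Metric.mem_closedBall_self hr.le)
  have hx : x ∈ Ioo (x - ε) (x + ε) := ⟨by linarith, by linarith⟩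
  obtain ⟨y, I, hy, hI, heq⟩ := hw.exists_isSolution isOpen_Ioo isPreconnected_Ioo ⟨x, hx⟩
  refine ⟨y, I, hy, hI hx, (heq hx).trans hp, ?_⟩
  rw [(eventuallyEq_of_mem (isOpen_Ioo.mem_nhds hx) heq).deriv_eq, hq]

theorem IsSolution.ordConnected {y : ℝ → ℝ} {I : Set ℝ} (h : IsSolution y I) : I.OrdConnected :=
  h.isPreconnected.ordConnected

/-- A maximal solution whose phase curve comes arbitrarily close to `(p, q, x)` is regular at `x`. -/
theorem IsSolution.mem_of_frequently {y : ℝ → ℝ} {I : Set ℝ} (h : IsSolution y I) {x p q : ℝ}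
    (hfr : ∃ᶠ z in 𝓝 (p, q, x), z.2.2 ∈ I ∧ z.1 = y z.2.2 ∧ z.2.1 = deriv y z.2.2) : x ∈ I := by
  classical
  obtain ⟨r, hr, ε, hε, H⟩ := exists_uniform_local_solution (p, q, x)
  -- Restarting at a time τ within ε/2 of x gives a solution on a window of radius ε, which contains
  -- x; glued to `y` it contradicts maximality unless x already lies in `I`.
  obtain ⟨⟨p', q', τ⟩, ⟨hτI, hp, hq⟩, hball⟩ := (hfr.and_eventually
    (Metric.closedBall_mem_nhds (p, q, x) (lt_min hr (half_pos hε)))).exists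
  simp only at hτI hp hq
  have hτx : |τ - x| ≤ ε / 2 := by
    have h1 : dist (p', q', τ) (p, q, x) ≤ ε / 2 := hball.trans (min_le_right _ _)
    calc |τ - x| = dist τ x := (Real.dist_eq _ _).symm
      _ ≤ dist (q', τ) (q, x) := le_max_right _ _
      _ ≤ dist (p', q', τ) (p, q, x) := le_max_right _ _
      _ ≤ _ := h1
  obtain ⟨w, hw, hwp, hwq⟩ := H p' q' τ (Metric.closedBall_subset_closedBall (min_le_left _ _) hball)
  set K := Ioo (τ - ε) (τ + ε) with hK
  have hτK : τ ∈ K := ⟨by linarith, by linarith⟩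
  have hxK : x ∈ K := ⟨by linarith [abs_le.1 hτx], by linarith [abs_le.1 hτx]⟩
  have heq : EqOn y w (I ∩ K) :=
    SolvesOn.eq_of_eq (h.ordConnected.inter ordConnected_Ioo) (h.isOpen.inter isOpen_Ioo)
      (h.solves.mono inter_subset_left) (hw.mono inter_subset_right) ⟨hτI, hτK⟩
      (by rw [hwp, hp]) (by rw [hwq, hq])
  let z : ℝ → ℝ := I.piecewise y w
  have hzI : EqOn z y I := fun t ht => piecewise_eq_of_mem _ _ _ ht
  have hzK : EqOn z w K := by
    intro t ht
    by_cases htI : t ∈ I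
    · rw [hzI htI, heq ⟨htI, ht⟩]
    · exact piecewise_eq_of_notMem _ _ _ htI
  refine h.maximal z (I ∪ K) (h.isOpen.union isOpen_Ioo)
    (h.isPreconnected.union τ hτI hτK isPreconnected_Ioo) ?_ subset_union_left hzI (Or.inr hxK)
  rintro t (ht | ht)
  · exact h.solves.of_eventuallyEq ht (eventuallyEq_of_mem (h.isOpen.mem_nhds ht) hzI)
  · exact hw.of_eventuallyEq ht (eventuallyEq_of_mem (isOpen_Ioo.mem_nhds ht) hzK)

/-- A maximal solution that stays bounded on the way from `x₁` to `x₂` is regular at `x₂`. -/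
theorem IsSolution.mem_of_bounded {y : ℝ → ℝ} {I : Set ℝ} (h : IsSolution y I) {x₁ x₂ M : ℝ}
    (h1 : x₁ ∈ I) (hM : ∀ x ∈ I ∩ uIcc x₁ x₂, |y x| ≤ M) : x₂ ∈ I := by
  by_contra h2
  set S := I ∩ uIcc x₁ x₂ with hS
  -- A bound on y bounds y'', hence y' along the segment, so the phase curve stays in a compact set.
  have hM' : ∀ x ∈ S, ‖6 * y x ^ 2 - x‖ ≤ 6 * M ^ 2 + (|x₁| + |x₂|) := by
    intro x hx
    have hy := hM x hx
    have hx' : |x| ≤ |x₁| + |x₂| := by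
      rcases mem_uIcc.1 hx.2 with h' | h' <;> rw [abs_le] <;> constructor <;>
      linarith [neg_abs_le x₁, le_abs_self x₁, neg_abs_le x₂, le_abs_self x₂, abs_nonneg x₁,
        abs_nonneg x₂]
    calc ‖6 * y x ^ 2 - x‖ ≤ |6 * y x ^ 2| + |x| := abs_sub _ _
      _ ≤ _ := by
        rw [abs_of_nonneg (by positivity), ← sq_abs (y x)]
        gcongr
  set L := 6 * M ^ 2 + (|x₁| + |x₂|)
  have hd : ∀ x ∈ S, |deriv y x| ≤ |deriv y x₁| + L * |x₂ - x₁| := by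
    intro x hx
    have := (h.ordConnected.inter
      ordConnected_uIcc).convex.norm_image_sub_le_of_norm_hasDerivWithin_le
      (fun x hx => (h.solves.hasDerivAt_deriv hx.1).hasDerivWithinAt) hM'
      (⟨h1, left_mem_uIcc⟩ : x₁ ∈ S) hx
    have hxx : |x - x₁| ≤ |x₂ - x₁| := abs_sub_left_of_mem_uIcc hx.2
    have hL : 0 ≤ L := by positivity
    rw [Real.norm_eq_abs, Real.norm_eq_abs] at this
    have h3 := mul_le_mul_of_nonneg_left hxx hL
    have h4 := abs_sub_abs_le_abs_sub (deriv y x) (deriv y x₁)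
    linarith
  set M₂ := |deriv y x₁| + L * |x₂ - x₁|
  -- Otherwise `S` would be closed as well as relatively open in the connected segment, and would
  -- contain x₂.
  obtain ⟨b, hbS, hbI⟩ : ∃ b ∈ closure S, b ∉ I := by
    by_contra! hcon
    have hcl : closure S ⊆ S := fun x hx => ⟨hcon x hx,
      (closure_minimal inter_subset_right isClosed_Icc) hx⟩
    have hclosed : IsClosed S := isClosed_of_closure_subset hcl
    rcases isPreconnected_iff_subset_of_disjoint.1 (isPreconnected_uIcc (a := x₁) (b := x₂)) I Sᶜ
      h.isOpen hclosed.isOpen_compl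
      (fun x hx => by by_cases hxI : x ∈ I; exacts [Or.inl hxI, Or.inr fun hc => hxI hc.1])
      (by
        ext x
        simp only [mem_inter_iff, mem_compl_iff, mem_empty_iff_false, iff_false, hS]
        tauto) with h' | h'
    · exact h2 (h' right_mem_uIcc)
    · exact h' left_mem_uIcc ⟨h1, left_mem_uIcc⟩
  have hne : (𝓝[S] b).NeBot := mem_closure_iff_nhdsWithin_neBot.1 hbS
  have hcomp : IsCompact (Icc (-M) M ×ˢ Icc (-M₂) M₂) := isCompact_Icc.prod isCompact_Icc
  obtain ⟨⟨p, q⟩, -, hcl⟩ := hcomp.exists_mapClusterPt (f := 𝓝[S] b)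
    (u := fun t => (y t, deriv y t))
    (by
      rw [le_principal_iff, mem_map]
      filter_upwards [self_mem_nhdsWithin] with t ht
      exact ⟨abs_le.1 (hM t ht), abs_le.1 (hd t ht)⟩)
  refine hbI (h.mem_of_frequently (p := p) (q := q) ?_)
  rw [frequently_iff]
  intro U hU
  rw [nhds_prod_eq, mem_prod_iff] at hU
  obtain ⟨A, hA, B, hB, hAB⟩ := hU
  rw [nhds_prod_eq, mem_prod_iff] at hB
  obtain ⟨B₁, hB₁, B₂, hB₂, hBB⟩ := hB
  have hfreq := hcl.frequently (prod_mem_nhds hA hB₁)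
  obtain ⟨t, ⟨⟨ht1, ht2⟩, htS⟩, ht3⟩ := ((hfreq.and_eventually self_mem_nhdsWithin).and_eventually
    (mem_nhdsWithin_of_mem_nhds hB₂)).exists
  exact ⟨(y t, deriv y t, t), hAB ⟨ht1, hBB ⟨ht2, ht3⟩⟩, htS.1, rfl, rfl⟩

/-! ### The travel time integral -/

/-- For `s = √(u - v)`, the energy of `u'' = 6 u ^ 2 + c`, `u = v` at rest, reads
`s' ^ 2 = quartic v c s`. -/
noncomputable def quartic (v c s : ℝ) : ℝ := s ^ 4 + 3 * v * s ^ 2 + 3 * v ^ 2 + c / 2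

noncomputable def kernel (v c s : ℝ) : ℝ := 1 / √(quartic v c s)

/-- Time the motion `u'' = 6 u ^ 2 + c` started at rest in `v` takes to reach `v + S ^ 2`. -/
noncomputable def travel (v c S : ℝ) : ℝ := ∫ s in (0 : ℝ)..S, kernel v c s

/-- Blow-up time of the motion `u'' = 6 u ^ 2 + c` started at rest in `v`. -/
noncomputable def blowup (v c : ℝ) : ℝ := ∫ s in Ioi (0 : ℝ), kernel v c s

theorem integralI_eq_blowup (v : ℝ) : integralI v = blowup v 1 := rfl

/-- The difference is 3(v + s²/2)². This bound is uniform in v and gives an integrable majorant;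
`quartic_ge_sq`, from a square in s², is uniform in s and gives decay for large |v|. -/
theorem quartic_ge_pow (v c s : ℝ) : s ^ 4 / 4 + c / 2 ≤ quartic v c s := by
  unfold quartic
  nlinarith [sq_nonneg (v + s ^ 2 / 2)]

theorem quartic_ge_sq (v c s : ℝ) : 3 / 4 * v ^ 2 + c / 2 ≤ quartic v c s := by
  unfold quartic
  nlinarith [sq_nonneg (s ^ 2 + 3 * v / 2)]

theorem half_le_quartic (v c s : ℝ) : c / 2 ≤ quartic v c s := by
  have := quartic_ge_sq v c s
  nlinarith [sq_nonneg v]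

theorem quartic_pos {c : ℝ} (hc : 0 < c) (v s : ℝ) : 0 < quartic v c s := by
  have := half_le_quartic v c s
  linarith

theorem kernel_pos {c : ℝ} (hc : 0 < c) (v s : ℝ) : 0 < kernel v c s :=
  one_div_pos.2 (Real.sqrt_pos.2 (quartic_pos hc v s))

theorem continuous_kernel {c : ℝ} (hc : 0 < c) : Continuous fun z : ℝ × ℝ => kernel z.1 c z.2 := by
  refine continuous_const.div ?_ fun z => (Real.sqrt_pos.2 (quartic_pos hc z.1 z.2)).ne'
  unfold quartic
  fun_prop

theorem continuous_kernel_right {c : ℝ} (hc : 0 < c) (v : ℝ) : Continuous (kernel v c) := by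
  refine continuous_const.div ?_ fun s => (Real.sqrt_pos.2 (quartic_pos hc v s)).ne'
  unfold quartic
  fun_prop

theorem continuous_kernel_left {c : ℝ} (hc : 0 < c) (s : ℝ) :
    Continuous fun v => kernel v c s := by
  refine continuous_const.div ?_ fun v => (Real.sqrt_pos.2 (quartic_pos hc v s)).ne'
  unfold quartic
  fun_prop

theorem kernel_lt_of_lt {c c' : ℝ} (hc : 0 < c) (h : c < c') (v s : ℝ) :
    kernel v c' s < kernel v c s := by
  refine one_div_lt_one_div_of_lt (Real.sqrt_pos.2 (quartic_pos hc v s)) ?_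
  refine Real.sqrt_lt_sqrt (quartic_pos hc v s).le ?_
  unfold quartic
  linarith

theorem exists_kernel_le {c : ℝ} (hc : 0 < c) :
    ∃ B, ∀ v s, kernel v c s ≤ B * (1 + s ^ 2)⁻¹ := by
  set m := min (1 / 8) (c / 4) with hm
  have hm0 : 0 < m := lt_min (by norm_num) (by linarith)
  refine ⟨1 / √m, fun v s => ?_⟩
  rw [kernel, ← one_div (1 + s ^ 2), one_div_mul_one_div]
  refine one_div_le_one_div_of_le (by positivity) (Real.le_sqrt_of_sq_le ?_)
  rw [mul_pow, Real.sq_sqrt hm0.le]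
  have h1 := quartic_ge_pow v c s
  have h2 : m * (1 + s ^ 2) ^ 2 ≤ m * (2 * s ^ 4) + m * 2 := by
    rw [← mul_add]
    exact mul_le_mul_of_nonneg_left (by nlinarith [sq_nonneg (s ^ 2 - 1)]) hm0.le
  have h3 : m * (2 * s ^ 4) ≤ 1 / 8 * (2 * s ^ 4) :=
    mul_le_mul_of_nonneg_right (min_le_left _ _) (by positivity)
  have h4 : m ≤ c / 4 := min_le_right _ _
  linarith

theorem integrable_kernel {c : ℝ} (hc : 0 < c) (v : ℝ) : Integrable (kernel v c) := by
  obtain ⟨B, hB⟩ := exists_kernel_le hc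
  refine (integrable_inv_one_add_sq.const_mul B).mono'
    (continuous_kernel_right hc v).aestronglyMeasurable (ae_of_all _ fun s => ?_)
  rw [Real.norm_of_nonneg (kernel_pos hc v s).le]
  exact hB v s

theorem continuous_blowup {c : ℝ} (hc : 0 < c) : Continuous fun v => blowup v c := by
  obtain ⟨B, hB⟩ := exists_kernel_le hc
  refine continuous_of_dominated (bound := fun s => B * (1 + s ^ 2)⁻¹)
    (fun v => (continuous_kernel_right hc v).aestronglyMeasurable)
    (fun v => ae_of_all _ fun s => ?_) (integrable_inv_one_add_sq.const_mul B).integrableOn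
    (ae_of_all _ fun s => continuous_kernel_left hc s)
  rw [Real.norm_of_nonneg (kernel_pos hc v s).le]
  exact hB v s

theorem tendsto_blowup {c : ℝ} (hc : 0 < c) :
    Tendsto (fun v => blowup v c) (cocompact ℝ) (𝓝 0) := by
  obtain ⟨B, hB⟩ := exists_kernel_le hc
  have : (cocompact ℝ).IsCountablyGenerated := by
    rw [cocompact_eq_atBot_atTop]
    infer_instance
  have hlim : Tendsto (fun v : ℝ => 2 / ‖v‖) (cocompact ℝ) (𝓝 0) :=
    (tendsto_norm_cocompact_atTop (E := ℝ)).const_div_atTop 2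
  have := tendsto_integral_filter_of_dominated_convergence (μ := volume.restrict (Ioi (0 : ℝ)))
    (l := cocompact ℝ) (F := fun v s => kernel v c s) (f := fun _ => 0)
    (fun s => B * (1 + s ^ 2)⁻¹)
    (Eventually.of_forall fun v => (continuous_kernel_right hc v).aestronglyMeasurable)
    (Eventually.of_forall fun v => ae_of_all _ fun s => by
      rw [Real.norm_of_nonneg (kernel_pos hc v s).le]
      exact hB v s)
    (integrable_inv_one_add_sq.const_mul B).integrableOn
    (ae_of_all _ fun s => by
      refine tendsto_of_tendsto_of_tendsto_of_le_of_le' tendsto_const_nhds hlim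
        (Eventually.of_forall fun v => (kernel_pos hc v s).le) ?_
      filter_upwards [(tendsto_norm_cocompact_atTop (E := ℝ)).eventually_gt_atTop 0] with v hv
      rw [kernel, show (2 : ℝ) / ‖v‖ = 1 / (‖v‖ / 2) by field_simp]
      refine one_div_le_one_div_of_le (by positivity) (Real.le_sqrt_of_sq_le ?_)
      have := quartic_ge_sq v c s
      rw [div_pow, Real.norm_eq_abs, sq_abs]
      nlinarith [sq_nonneg v])
  simpa [blowup] using this

theorem blowup_pos {c : ℝ} (hc : 0 < c) (v : ℝ) : 0 < blowup v c := by
  rw [blowup, setIntegral_pos_iff_support_of_nonneg_ae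
    (ae_of_all _ fun s => (kernel_pos hc v s).le) (integrable_kernel hc v).integrableOn]
  rw [show Function.support (kernel v c) = univ from
    eq_univ_of_forall fun s => (kernel_pos hc v s).ne', univ_inter]
  simp

/-! ### The maximum of the blow-up time lies at negative v -/

/-- Tangent line inequality for `q ↦ 1 / √q`. -/
theorem one_div_sqrt_add_ge {q h : ℝ} (hq : 0 < q) (hqh : 0 < q + h) :
    1 / √q - h * (1 / (2 * (q * √q))) ≤ 1 / √(q + h) := by
  have ha := Real.sqrt_pos.2 hq
  have hb := Real.sqrt_pos.2 hqh
  have ha2 := Real.sq_sqrt hq.le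
  have hb2 := Real.sq_sqrt hqh.le
  set a := √q
  set b := √(q + h)
  have hh : h = b ^ 2 - a ^ 2 := by rw [ha2, hb2]; ring
  rw [← ha2, hh]
  have : 1 / b - (1 / a - (b ^ 2 - a ^ 2) * (1 / (2 * (a ^ 2 * a)))) =
      (a - b) ^ 2 * (2 * a + b) / (2 * a ^ 3 * b) := by
    field_simp
    ring
  have h2 : 0 ≤ (a - b) ^ 2 * (2 * a + b) / (2 * a ^ 3 * b) := by positivity
  linarith

/-- To first order at v = 0 the quartic changes by 3vs², so a small negative v lengthens the blow-up
time. Convexity of q ↦ 1/√q makes this a rigorous lower bound. -/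
theorem exists_blowup_gt_zero : ∃ v < 0, blowup 0 1 < blowup v 1 := by
  set q : ℝ → ℝ := fun s => quartic 0 1 s with hq
  have hqp : ∀ s, 1 / 2 ≤ q s := fun s => half_le_quartic 0 1 s
  have hqpos : ∀ s, 0 < q s := fun s => quartic_pos one_pos 0 s
  set g : ℝ → ℝ := fun s => 1 / (2 * (q s * √(q s))) with hg
  have hgpos : ∀ s, 0 < g s := fun s => by
    have := hqpos s
    have := Real.sqrt_pos.2 this
    simp only [hg]
    positivity
  have hgc : Continuous g := by
    have hqc : Continuous q := by simp only [hq, quartic]; fun_prop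
    refine continuous_const.div (by fun_prop) fun s => ?_
    have := hqpos s
    have := Real.sqrt_pos.2 this
    positivity
  have hgeq : ∀ s, g s = 1 / (2 * q s) * kernel 0 1 s := fun s => by
    simp only [hg, kernel, hq]
    rw [one_div_mul_one_div, mul_assoc]
  have hgi : Integrable g := by
    refine (integrable_kernel one_pos 0).mono' hgc.aestronglyMeasurable (ae_of_all _ fun s => ?_)
    rw [Real.norm_of_nonneg (hgpos s).le, hgeq]
    refine mul_le_of_le_one_left (kernel_pos one_pos 0 s).le ?_
    rw [div_le_one (by linarith [hqpos s])]
    linarith [hqp s]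
  have hgi2 : Integrable fun s => s ^ 2 * g s := by
    refine (integrable_kernel one_pos 0).mono' (by fun_prop) (ae_of_all _ fun s => ?_)
    rw [Real.norm_of_nonneg (mul_nonneg (sq_nonneg s) (hgpos s).le), hgeq, ← mul_assoc]
    refine mul_le_of_le_one_left (kernel_pos one_pos 0 s).le ?_
    rw [mul_one_div, div_le_one (by linarith [hqpos s])]
    simp only [hq, quartic]
    nlinarith [sq_nonneg (s ^ 2 - 1 / 2)]
  set A := ∫ s in Ioi (0 : ℝ), g s with hA
  set B := ∫ s in Ioi (0 : ℝ), s ^ 2 * g s with hB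
  have hApos : 0 < A := by
    rw [hA, setIntegral_pos_iff_support_of_nonneg_ae (ae_of_all _ fun s => (hgpos s).le)
      hgi.integrableOn, show Function.support g = univ from
        eq_univ_of_forall fun s => (hgpos s).ne', univ_inter]
    simp
  have hBpos : 0 < B := by
    rw [hB, setIntegral_pos_iff_support_of_nonneg_ae
      (ae_of_all _ fun s => mul_nonneg (sq_nonneg s) (hgpos s).le) hgi2.integrableOn]
    rw [show Function.support (fun s => s ^ 2 * g s) ∩ Ioi 0 = Ioi 0 from
      inter_eq_right.2 fun s hs =>
        (mul_pos (pow_pos (mem_Ioi.1 hs) 2) (hgpos s)).ne']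
    simp
  -- This r maximises the guaranteed gain 3rB - 3r²A, whose value is then 3B²/(4A).
  set r := B / (2 * A) with hr
  have hrpos : 0 < r := by positivity
  refine ⟨-r, by linarith, ?_⟩
  have hpt : ∀ s, kernel 0 1 s + (3 * r * (s ^ 2 * g s) - 3 * r ^ 2 * g s) ≤ kernel (-r) 1 s := by
    intro s
    have hadd : quartic (-r) 1 s = q s + (-3 * r * s ^ 2 + 3 * r ^ 2) := by
      simp only [hq, quartic]; ring
    have := one_div_sqrt_add_ge (hqpos s) (h := -3 * r * s ^ 2 + 3 * r ^ 2)
      (hadd ▸ quartic_pos one_pos (-r) s)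
    rw [← hadd] at this
    simp only [kernel]
    refine le_trans (le_of_eq ?_) this
    simp only [hg, hq]
    ring
  have hi1 := (integrable_kernel one_pos 0).integrableOn (s := Ioi 0)
  have hi2 := (hgi2.const_mul (3 * r)).integrableOn (s := Ioi 0)
  have hi3 := (hgi.const_mul (3 * r ^ 2)).integrableOn (s := Ioi 0)
  have hint : blowup 0 1 + (3 * r * B - 3 * r ^ 2 * A) ≤ blowup (-r) 1 := by
    have h1 : ∫ s in Ioi (0 : ℝ), (kernel 0 1 s + (3 * r * (s ^ 2 * g s) - 3 * r ^ 2 * g s)) =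
        blowup 0 1 + (3 * r * B - 3 * r ^ 2 * A) := by
      have e1 := integral_add hi1 (hi2.sub hi3)
      have e2 := integral_sub hi2 hi3
      rw [integral_const_mul, integral_const_mul] at e2
      simp only [Pi.sub_apply] at e1
      rw [e1, e2, blowup]
    rw [← h1]
    exact integral_mono (hi1.add (hi2.sub hi3)) (integrable_kernel one_pos (-r)).integrableOn hpt
  have : 3 * r * B - 3 * r ^ 2 * A = 3 * B ^ 2 / (4 * A) := by
    rw [hr]; field_simp; ring
  have h2 : 0 < 3 * B ^ 2 / (4 * A) := by positivity
  linarith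

theorem blowup_le_blowup_zero {v : ℝ} (hv : 0 ≤ v) : blowup v 1 ≤ blowup 0 1 := by
  refine integral_mono (integrable_kernel one_pos v).integrableOn
    (integrable_kernel one_pos 0).integrableOn fun s => ?_
  refine one_div_le_one_div_of_le (Real.sqrt_pos.2 (quartic_pos one_pos 0 s)) ?_
  refine Real.sqrt_le_sqrt ?_
  unfold quartic
  nlinarith [mul_nonneg hv (sq_nonneg s), sq_nonneg v]

/-- Continuity and decay at infinity give a maximum over all real v; values at v ≥ 0 do not exceed
the one at 0, which some negative v beats. -/
theorem exists_blowup_max : ∃ v < 0, ∀ w, blowup w 1 ≤ blowup v 1 := by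
  obtain ⟨v₁, hv₁, h1⟩ := exists_blowup_gt_zero
  obtain ⟨v, hv⟩ := (continuous_blowup one_pos).exists_forall_ge' 0
    (((tendsto_blowup one_pos).eventually_lt_const (blowup_pos one_pos 0)).mono fun _ h => h.le)
  refine ⟨v, ?_, hv⟩
  by_contra! h
  exact absurd (hv v₁) (not_le.2 ((blowup_le_blowup_zero h).trans_lt h1))

theorem isGreatest_C : IsGreatest (integralI '' Iio 0) C := by
  obtain ⟨v, hv, hmax⟩ := exists_blowup_max
  have : IsGreatest (integralI '' Iio 0) (integralI v) :=
    ⟨⟨v, hv, rfl⟩, by rintro _ ⟨w, _, rfl⟩; exact hmax w⟩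
  rwa [C, this.csSup_eq]

theorem blowup_one_le_C (v : ℝ) : blowup v 1 ≤ C := by
  obtain ⟨w, hw, hmax⟩ := exists_blowup_max
  exact (hmax v).trans (isGreatest_C.2 ⟨w, hw, rfl⟩)

theorem C_pos : 0 < C := (blowup_pos one_pos 0).trans_le (blowup_one_le_C 0)

/-! ### Scaling in the coefficient -/

/-- Substitute s = l·w: the quartic is homogeneous of degree four when v has weight 2 and c has
weight 4. -/
theorem blowup_pow_four {l : ℝ} (hl : 0 < l) (v : ℝ) :
    blowup v (l ^ 4) = blowup (v / l ^ 2) 1 / l := by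
  have h := integral_comp_mul_left_Ioi (kernel v (l ^ 4)) 0 hl
  have h1 : ∀ s, kernel v (l ^ 4) (l * s) = 1 / l ^ 2 * kernel (v / l ^ 2) 1 s := by
    intro s
    have : quartic v (l ^ 4) (l * s) = (l ^ 2) ^ 2 * quartic (v / l ^ 2) 1 s := by
      unfold quartic
      field_simp
    rw [kernel, this, Real.sqrt_mul (by positivity), Real.sqrt_sq (by positivity), kernel,
      one_div_mul_one_div]
  simp_rw [h1] at h
  rw [integral_const_mul, mul_zero, smul_eq_mul] at h
  change 1 / l ^ 2 * blowup _ 1 = l⁻¹ * blowup v (l ^ 4) at h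
  field_simp at h ⊢
  linarith

theorem rpow_quarter_pow {c : ℝ} (hc : 0 ≤ c) : (c ^ (1 / 4 : ℝ)) ^ 4 = c := by
  rw [← Real.rpow_natCast, ← Real.rpow_mul hc]
  norm_num

theorem blowup_le {c : ℝ} (hc : 0 < c) (v : ℝ) : blowup v c ≤ C / c ^ (1 / 4 : ℝ) := by
  have hl := Real.rpow_pos_of_pos hc (1 / 4)
  conv_lhs => rw [← rpow_quarter_pow hc.le, blowup_pow_four hl]
  exact div_le_div_of_nonneg_right (blowup_one_le_C _) hl.le

theorem exists_blowup_eq {c : ℝ} (hc : 0 < c) : ∃ v, blowup v c = C / c ^ (1 / 4 : ℝ) := by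
  have hl := Real.rpow_pos_of_pos hc (1 / 4)
  obtain ⟨v, -, hv⟩ := isGreatest_C.1
  refine ⟨v * (c ^ (1 / 4 : ℝ)) ^ 2, ?_⟩
  have h := blowup_pow_four hl (v * (c ^ (1 / 4 : ℝ)) ^ 2)
  rw [rpow_quarter_pow hc.le] at h
  rw [h, mul_div_cancel_right₀ _ (by positivity), ← hv, integralI_eq_blowup]

/-! ### Partial travel times -/

theorem hasDerivAt_travel {c : ℝ} (hc : 0 < c) (v S : ℝ) :
    HasDerivAt (travel v c) (kernel v c S) S :=
  ((continuous_kernel_right hc v).integral_hasStrictDerivAt 0 S).hasDerivAt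

theorem travel_zero (v c : ℝ) : travel v c 0 = 0 := intervalIntegral.integral_same

theorem strictMono_travel {c : ℝ} (hc : 0 < c) (v : ℝ) : StrictMono (travel v c) :=
  strictMono_of_deriv_pos fun S => by
    rw [(hasDerivAt_travel hc v S).deriv]
    exact kernel_pos hc v S

theorem tendsto_travel {c : ℝ} (hc : 0 < c) (v : ℝ) :
    Tendsto (travel v c) atTop (𝓝 (blowup v c)) :=
  intervalIntegral_tendsto_integral_Ioi 0 (integrable_kernel hc v).integrableOn tendsto_id

theorem travel_le_blowup {c : ℝ} (hc : 0 < c) (v S : ℝ) : travel v c S ≤ blowup v c :=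
  (strictMono_travel hc v).monotone.ge_of_tendsto (tendsto_travel hc v) S

/-- The time saved by the larger coefficient accumulates along the way. -/
theorem strictMono_travel_sub_travel {c c' : ℝ} (hc : 0 < c) (h : c < c') (v : ℝ) :
    StrictMono fun S => travel v c S - travel v c' S :=
  strictMono_of_deriv_pos fun S => by
    rw [((hasDerivAt_travel hc v S).fun_sub (hasDerivAt_travel (hc.trans h) v S)).deriv]
    exact sub_pos.2 (kernel_lt_of_lt hc h v S)

theorem travel_sub_travel_le_blowup {c c' : ℝ} (hc : 0 < c) (h : c < c') (v S : ℝ) :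
    travel v c S - travel v c' S ≤ blowup v c - blowup v c' :=
  (strictMono_travel_sub_travel hc h v).monotone.ge_of_tendsto
    ((tendsto_travel hc v).sub (tendsto_travel (hc.trans h) v)) S

theorem continuous_travel_left {c : ℝ} (hc : 0 < c) (S : ℝ) : Continuous fun v => travel v c S :=
  intervalIntegral.continuous_parametric_intervalIntegral_of_continuous' (continuous_kernel hc) 0 S

theorem kernel_le_two_div_sq {c s : ℝ} (hc : 0 < c) (hs : 0 < s) (v : ℝ) :
    kernel v c s ≤ 2 / s ^ 2 := by
  rw [kernel, show 2 / s ^ 2 = 1 / (s ^ 2 / 2) by field_simp]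
  refine one_div_le_one_div_of_le (by positivity) (Real.le_sqrt_of_sq_le ?_)
  have := quartic_ge_pow v c s
  nlinarith

theorem travel_sub_le_two_div {c a b : ℝ} (hc : 0 < c) (ha : 0 < a) (hab : a ≤ b) (v : ℝ) :
    travel v c b - travel v c a ≤ 2 / a := by
  have hanti : AntitoneOn (fun s => travel v c s + 2 / s) (Ici a) := by
    have hd : ∀ s ∈ Ici a, HasDerivAt (fun s => travel v c s + 2 / s)
        (kernel v c s + -(2 / s ^ 2)) s := fun s hs => by
      have hs0 : s ≠ 0 := (ha.trans_le hs).ne'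
      have := ((hasDerivAt_inv hs0).const_mul 2)
      refine (hasDerivAt_travel hc v s).fun_add (this.congr_deriv ?_ |>.congr_of_eventuallyEq ?_)
      · field_simp
      · exact Eventually.of_forall fun t => div_eq_mul_inv 2 t
    refine antitoneOn_of_deriv_nonpos (convex_Ici a)
      (fun s hs => (hd s hs).continuousAt.continuousWithinAt)
      (fun s hs => (hd s (interior_subset hs)).differentiableAt.differentiableWithinAt)
      fun s hs => ?_
    have hs' := interior_subset hs
    rw [(hd s hs').deriv]
    linarith [kernel_le_two_div_sq hc (ha.trans_le hs') v]
  have := hanti (mem_Ici.2 le_rfl) (mem_Ici.2 hab) hab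
  simp only at this
  have h2 : 0 < 2 / b := div_pos two_pos (ha.trans_le hab)
  linarith

/-- Gaining the coefficient `c' > c` while `s` runs through a fixed interval shortens the blow-up
time by an amount that does not depend on the initial value. -/
theorem exists_uniform_gain {c c' S₁ S₂ : ℝ} (hc : 0 < c) (h : c < c') (hS : S₁ < S₂) :
    ∃ ε > 0, ∀ v, blowup v c - ((travel v c S₂ - travel v c' S₂) -
      (travel v c S₁ - travel v c' S₁)) ≤ C / c ^ (1 / 4 : ℝ) - ε := by
  have hc' := hc.trans h
  set D := C / c ^ (1 / 4 : ℝ) with hD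
  have hDpos : 0 < D := div_pos C_pos (Real.rpow_pos_of_pos hc _)
  set G : ℝ → ℝ := fun v => blowup v c - ((travel v c S₂ - travel v c' S₂) -
      (travel v c S₁ - travel v c' S₁)) with hG
  have hGlt : ∀ v, G v < blowup v c := fun v => by
    have := strictMono_travel_sub_travel hc h v hS
    simp only [hG] at this ⊢
    linarith
  have hGc : Continuous G := (continuous_blowup hc).sub
    (((continuous_travel_left hc _).sub (continuous_travel_left hc' _)).sub
      ((continuous_travel_left hc _).sub (continuous_travel_left hc' _)))
  -- `G` is below D/2 far out, so truncating it from below at D/2 makes a maximum exist; it is less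
  -- than D because `G` is pointwise below `blowup`.
  have hev : ∀ᶠ v in cocompact ℝ, max (G v) (D / 2) ≤ max (G 0) (D / 2) := by
    filter_upwards [(tendsto_blowup hc).eventually_lt_const (half_pos hDpos)] with v hv
    rw [max_eq_right ((hGlt v).trans hv).le]
    exact le_max_right _ _
  obtain ⟨v₀, hv₀⟩ := (hGc.max (continuous_const (y := D / 2))).exists_forall_ge' 0 hev
  refine ⟨D - max (G v₀) (D / 2), ?_, fun v => ?_⟩
  · have : max (G v₀) (D / 2) < D := max_lt ((hGlt v₀).trans_le (blowup_le hc v₀)) (half_lt_self hDpos)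
    linarith
  · have := (le_max_left (G v) (D / 2)).trans (hv₀ v)
    linarith

/-! ### Comparison with the autonomous motion -/

theorem energy_eq_quartic {u v c : ℝ} (h : v ≤ u) :
    4 * (u ^ 3 - v ^ 3) + 2 * c * (u - v) = (2 * √(u - v)) ^ 2 * quartic v c √(u - v) := by
  have hs := Real.sq_sqrt (sub_nonneg.2 h)
  have hs4 : √(u - v) ^ 4 = (u - v) ^ 2 := by
    calc √(u - v) ^ 4 = (√(u - v) ^ 2) ^ 2 := by ring
      _ = _ := by rw [hs]
  rw [quartic, mul_pow, hs4, hs]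
  ring

theorem hasDerivAt_travel_sqrt {u : ℝ → ℝ} {v c p σ : ℝ} (hc : 0 < c) (hu : HasDerivAt u p σ)
    (hv : v < u σ) : HasDerivAt (fun σ => travel v c √(u σ - v) - σ)
      (kernel v c √(u σ - v) * (p / (2 * √(u σ - v))) - 1) σ := by
  have h1 : HasDerivAt (fun σ => √(u σ - v)) (p / (2 * √(u σ - v))) σ :=
    (hu.sub_const v).sqrt (sub_pos.2 hv).ne'
  have h2 := (hasDerivAt_travel hc v (√(u σ - v))).comp σ h1
  exact h2.fun_sub (hasDerivAt_id' σ)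

theorem kernel_mul_speed (u v c p : ℝ) :
    kernel v c √(u - v) * (p / (2 * √(u - v))) =
      p / (2 * √(u - v) * √(quartic v c √(u - v))) := by
  rw [kernel, div_mul_div_comm, one_mul, mul_comm √(quartic _ _ _)]

theorem continuousOn_travel_sqrt {u p : ℝ → ℝ} {v c α β : ℝ} (hc : 0 < c)
    (hu : ∀ σ ∈ Icc α β, HasDerivAt u (p σ) σ) :
    ContinuousOn (fun σ => travel v c √(u σ - v) - σ) (Icc α β) := fun σ hσ => by
  have h1 : ContinuousAt (fun σ => √(u σ - v)) σ :=
    ((hu σ hσ).continuousAt.sub continuousAt_const).sqrt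
  have h2 : ContinuousAt (fun σ => travel v c √(u σ - v)) σ :=
    ContinuousAt.comp' (hasDerivAt_travel hc v _).continuousAt h1
  exact (h2.sub continuousAt_id).continuousWithinAt

/-- The energy inequality says that s = √(u - v) moves at least as fast as the autonomous motion, so
its travel time minus the elapsed time does not decrease. The conditions are imposed on the open
interval because the square root is singular where u = v. -/
theorem le_travel_sub {u p : ℝ → ℝ} {v c α β : ℝ} (hc : 0 < c) (hαβ : α ≤ β)
    (hu : ∀ σ ∈ Icc α β, HasDerivAt u (p σ) σ) (hv : ∀ σ ∈ Ioo α β, v < u σ)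
    (hp : ∀ σ ∈ Ioo α β, 0 ≤ p σ)
    (hE : ∀ σ ∈ Ioo α β, 4 * (u σ ^ 3 - v ^ 3) + 2 * c * (u σ - v) ≤ p σ ^ 2) :
    β - α ≤ travel v c √(u β - v) - travel v c √(u α - v) := by
  have hmono : MonotoneOn (fun σ => travel v c √(u σ - v) - σ) (Icc α β) := by
    refine monotoneOn_of_deriv_nonneg (convex_Icc α β) (continuousOn_travel_sqrt hc hu)
      (fun σ hσ => ?_) fun σ hσ => ?_ <;> rw [interior_Icc] at hσ
    · exact (hasDerivAt_travel_sqrt hc (hu σ (Ioo_subset_Icc_self hσ))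
        (hv σ hσ)).differentiableAt.differentiableWithinAt
    · rw [(hasDerivAt_travel_sqrt hc (hu σ (Ioo_subset_Icc_self hσ)) (hv σ hσ)).deriv,
        kernel_mul_speed, sub_nonneg, one_le_div (mul_pos (mul_pos two_pos
          (Real.sqrt_pos.2 (sub_pos.2 (hv σ hσ)))) (Real.sqrt_pos.2 (quartic_pos hc _ _)))]
      refine abs_le_of_sq_le_sq' ?_ (hp σ hσ) |>.2
      rw [mul_pow, Real.sq_sqrt (quartic_pos hc _ _).le, ← energy_eq_quartic (hv σ hσ).le]
      exact hE σ hσ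
  have := hmono (left_mem_Icc.2 hαβ) (right_mem_Icc.2 hαβ) hαβ
  simp only at this
  linarith

theorem travel_sub_lt {u p : ℝ → ℝ} {v c α β : ℝ} (hc : 0 < c) (hαβ : α < β)
    (hu : ∀ σ ∈ Icc α β, HasDerivAt u (p σ) σ) (hv : ∀ σ ∈ Ioo α β, v < u σ)
    (hE : ∀ σ ∈ Ioo α β, p σ ^ 2 < 4 * (u σ ^ 3 - v ^ 3) + 2 * c * (u σ - v)) :
    travel v c √(u β - v) - travel v c √(u α - v) < β - α := by
  have hmono : StrictAntiOn (fun σ => travel v c √(u σ - v) - σ) (Icc α β) := by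
    refine strictAntiOn_of_deriv_neg (convex_Icc α β) (continuousOn_travel_sqrt hc hu)
      fun σ hσ => ?_
    rw [interior_Icc] at hσ
    have hpos := mul_pos (mul_pos two_pos
          (Real.sqrt_pos.2 (sub_pos.2 (hv σ hσ)))) (Real.sqrt_pos.2 (quartic_pos hc v √(u σ - v)))
    rw [(hasDerivAt_travel_sqrt hc (hu σ (Ioo_subset_Icc_self hσ)) (hv σ hσ)).deriv,
      kernel_mul_speed, sub_neg, div_lt_one hpos]
    refine abs_lt_of_sq_lt_sq' ?_ hpos.le |>.2
    rw [mul_pow, Real.sq_sqrt (quartic_pos hc _ _).le, ← energy_eq_quartic (hv σ hσ).le]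
    exact hE σ hσ
  have := hmono (left_mem_Icc.2 hαβ.le) (right_mem_Icc.2 hαβ.le) hαβ
  simp only at this
  linarith

/-! ### Motions with variable coefficient -/

/-- `u` solves `u'' = 6 u ^ 2 + k` on `[0, L]` with velocity `p`, initially nonnegative. -/
structure Flow (u p k : ℝ → ℝ) (L : ℝ) : Prop where
  deriv_pos : ∀ σ ∈ Icc 0 L, HasDerivAt u (p σ) σ
  deriv_vel : ∀ σ ∈ Icc 0 L, HasDerivAt p (6 * u σ ^ 2 + k σ) σ
  coeff_pos : ∀ σ ∈ Ioo 0 L, 0 < k σ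
  vel_zero : 0 ≤ p 0

namespace Flow

variable {u p k : ℝ → ℝ} {L : ℝ}

theorem strictMonoOn_vel (h : Flow u p k L) : StrictMonoOn p (Icc 0 L) := by
  refine strictMonoOn_of_deriv_pos (convex_Icc 0 L)
    (fun σ hσ => (h.deriv_vel σ hσ).continuousAt.continuousWithinAt) fun σ hσ => ?_
  rw [interior_Icc] at hσ
  rw [(h.deriv_vel σ (Ioo_subset_Icc_self hσ)).deriv]
  have := h.coeff_pos σ hσ
  positivity

theorem vel_pos (h : Flow u p k L) {σ : ℝ} (hσ : σ ∈ Ioc 0 L) : 0 < p σ :=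
  h.vel_zero.trans_lt (h.strictMonoOn_vel (left_mem_Icc.2 (hσ.1.le.trans hσ.2))
    (Ioc_subset_Icc_self hσ) hσ.1)

theorem strictMonoOn_pos (h : Flow u p k L) : StrictMonoOn u (Icc 0 L) := by
  refine strictMonoOn_of_deriv_pos (convex_Icc 0 L)
    (fun σ hσ => (h.deriv_pos σ hσ).continuousAt.continuousWithinAt) fun σ hσ => ?_
  rw [interior_Icc] at hσ
  rw [(h.deriv_pos σ (Ioo_subset_Icc_self hσ)).deriv]
  exact h.vel_pos (Ioo_subset_Ioc_self hσ)

theorem pos_gt (h : Flow u p k L) {σ : ℝ} (hσ : σ ∈ Ioc 0 L) : u 0 < u σ :=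
  h.strictMonoOn_pos (left_mem_Icc.2 (hσ.1.le.trans hσ.2)) (Ioc_subset_Icc_self hσ) hσ.1

theorem mono (h : Flow u p k L) {L' : ℝ} (hL : L' ≤ L) : Flow u p k L' where
  deriv_pos σ hσ := h.deriv_pos σ ⟨hσ.1, hσ.2.trans hL⟩
  deriv_vel σ hσ := h.deriv_vel σ ⟨hσ.1, hσ.2.trans hL⟩
  coeff_pos σ hσ := h.coeff_pos σ ⟨hσ.1, hσ.2.trans_le hL⟩
  vel_zero := h.vel_zero

theorem hasDerivAt_energy (h : Flow u p k L) (c : ℝ) {g : ℝ → ℝ} {g' σ : ℝ} (hσ : σ ∈ Icc 0 L)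
    (hg : HasDerivAt g g' σ) :
    HasDerivAt (fun σ => p σ ^ 2 - 4 * (u σ ^ 3 - u 0 ^ 3) - (2 * c + g σ) * (u σ - u 0))
      (2 * p σ * (k σ - c) - (g' * (u σ - u 0) + g σ * p σ)) σ := by
  have hu := h.deriv_pos σ hσ
  have hp := h.deriv_vel σ hσ
  have h1 := ((hp.fun_pow 2).fun_sub (((hu.fun_pow 3).sub_const (u 0 ^ 3)).const_mul 4)).fun_sub
    ((hg.const_add (2 * c)).fun_mul (hu.sub_const (u 0)))
  refine h1.congr_deriv ?_
  norm_num
  ring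

/-- The energy gained from a coefficient exceeding `c`. -/
theorem energy_le (h : Flow u p k L) {c : ℝ} {g g' : ℝ → ℝ}
    (hg : ∀ σ ∈ Icc 0 L, HasDerivAt g (g' σ) σ)
    (hk : ∀ σ ∈ Ioo 0 L, g' σ * (u σ - u 0) + g σ * p σ ≤ 2 * p σ * (k σ - c)) {σ : ℝ}
    (hσ : σ ∈ Icc 0 L) :
    4 * (u σ ^ 3 - u 0 ^ 3) + (2 * c + g σ) * (u σ - u 0) ≤ p σ ^ 2 := by
  -- This quantity starts at p(0)² ≥ 0: an initial velocity only adds energy.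
  have hmono : MonotoneOn
      (fun σ => p σ ^ 2 - 4 * (u σ ^ 3 - u 0 ^ 3) - (2 * c + g σ) * (u σ - u 0)) (Icc 0 L) := by
    refine monotoneOn_of_deriv_nonneg (convex_Icc 0 L)
      (fun σ hσ => (h.hasDerivAt_energy c hσ (hg σ hσ)).continuousAt.continuousWithinAt)
      (fun σ hσ => (h.hasDerivAt_energy c (interior_subset hσ)
        (hg σ (interior_subset hσ))).differentiableAt.differentiableWithinAt) fun σ hσ => ?_
    rw [(h.hasDerivAt_energy c (interior_subset hσ) (hg σ (interior_subset hσ))).deriv]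
    rw [interior_Icc] at hσ
    linarith [hk σ hσ]
  have := hmono (left_mem_Icc.2 (hσ.1.trans hσ.2)) hσ hσ.1
  simp only [sub_self, mul_zero, sub_zero] at this
  nlinarith [sq_nonneg (p 0)]

/-- The reverse comparison needs a start at rest, since initial kinetic energy would spoil the upper
bound. -/
theorem lt_energy (h : Flow u p k L) {c : ℝ} (h0 : p 0 = 0) (hk : ∀ σ ∈ Ioo 0 L, k σ < c) {σ : ℝ}
    (hσ : σ ∈ Ioc 0 L) :
    p σ ^ 2 < 4 * (u σ ^ 3 - u 0 ^ 3) + 2 * c * (u σ - u 0) := by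
  have hd : ∀ σ ∈ Icc 0 L, _ := fun σ hσ => h.hasDerivAt_energy c hσ (hasDerivAt_const σ (0 : ℝ))
  have hmono := strictAntiOn_of_deriv_neg (convex_Icc 0 L)
    (fun σ hσ => (hd σ hσ).continuousAt.continuousWithinAt) fun σ hσ => by
      rw [(hd σ (interior_subset hσ)).deriv]
      rw [interior_Icc] at hσ
      have h1 := h.vel_pos (Ioo_subset_Ioc_self hσ)
      have h2 := hk σ hσ
      nlinarith [mul_pos h1 (sub_pos.2 h2)]
  have := hmono (left_mem_Icc.2 (hσ.1.le.trans hσ.2)) (Ioc_subset_Icc_self hσ) hσ.1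
  simp only [sub_self, mul_zero, sub_zero, h0] at this
  linarith

/-- Lifetime of a motion with growing coefficient. -/
theorem exists_lifetime_increasing {c : ℝ} (hc : 0 < c) :
    ∃ ε > 0, ∀ (u p : ℝ → ℝ) (L : ℝ), Flow u p (fun σ => c + σ) L →
      L ≤ C / c ^ (1 / 4 : ℝ) - ε := by
  set D := C / c ^ (1 / 4 : ℝ) with hD
  have hDpos : 0 < D := div_pos C_pos (Real.rpow_pos_of_pos hc _)
  set c' := c + D / 4 with hc'
  have hcc' : c < c' := by linarith
  have hc'0 : 0 < c' := hc.trans hcc'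
  obtain ⟨ε, hε, hgain⟩ := exists_uniform_gain (S₁ := 8 / D) (S₂ := 8 / D + 1) hc hcc' (by linarith)
  refine ⟨min ε (D / 4), by positivity, fun u p L h => ?_⟩
  have hm1 := min_le_left ε (D / 4)
  have hm2 := min_le_right ε (D / 4)
  rcases le_or_gt L (D / 2) with hL | hL
  · linarith
  have hE : ∀ σ ∈ Icc 0 L, 4 * (u σ ^ 3 - u 0 ^ 3) + (2 * c + σ) * (u σ - u 0) ≤ p σ ^ 2 := by
    intro σ hσ
    -- Velocity increases, so u - u(0) ≤ σp; this makes c + σ/2 an admissible effective coefficient,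
    -- which is at least `c'` from time D/2 on.
    refine h.energy_le (g := fun σ => σ) (g' := fun _ => 1) (fun σ _ => hasDerivAt_id' σ)
      (fun τ hτ => ?_) hσ
    have hconv : u τ - u 0 ≤ τ * p τ := by
      have := (convex_Icc 0 τ).image_sub_le_mul_sub_of_deriv_le (f := u) (C := p τ)
        (fun s hs => (h.deriv_pos s ⟨hs.1, hs.2.trans hτ.2.le⟩).continuousAt.continuousWithinAt)
        (fun s hs => (h.deriv_pos s ⟨(interior_subset hs).1,
          (interior_subset hs).2.trans hτ.2.le⟩).differentiableAt.differentiableWithinAt)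
        (fun s hs => by
          have hs' := interior_subset hs
          have hsL : s ∈ Icc 0 L := ⟨hs'.1, hs'.2.trans hτ.2.le⟩
          rw [(h.deriv_pos s hsL).deriv]
          exact h.strictMonoOn_vel.monotoneOn hsL (Ioo_subset_Icc_self hτ) hs'.2)
        0 (left_mem_Icc.2 hτ.1.le) τ (right_mem_Icc.2 hτ.1.le) hτ.1.le
      linarith
    linarith
  set δ := D / 2 with hδ
  have hδ0 : 0 < δ := half_pos hDpos
  set s₁ := √(u δ - u 0) with hs₁
  have ht1 : δ - 0 ≤ travel (u 0) c s₁ - travel (u 0) c √(u 0 - u 0) :=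
    le_travel_sub hc hδ0.le (h.mono hL.le).deriv_pos
      (fun σ hσ => h.pos_gt ⟨hσ.1, (hσ.2.trans hL).le⟩)
      (fun σ hσ => (h.vel_pos ⟨hσ.1, (hσ.2.trans hL).le⟩).le) fun σ hσ => by
        have := hE σ ⟨hσ.1.le, (hσ.2.trans hL).le⟩
        nlinarith [mul_pos hσ.1 (sub_pos.2 (h.pos_gt ⟨hσ.1, (hσ.2.trans hL).le⟩))]
  rw [sub_self, Real.sqrt_zero, travel_zero, sub_zero, sub_zero] at ht1
  have ht2 : L - δ ≤ travel (u 0) c' √(u L - u 0) - travel (u 0) c' s₁ :=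
    le_travel_sub hc'0 hL.le (fun σ hσ => h.deriv_pos σ ⟨hδ0.le.trans hσ.1, hσ.2⟩)
      (fun σ hσ => h.pos_gt ⟨hδ0.trans hσ.1, hσ.2.le⟩)
      (fun σ hσ => (h.vel_pos ⟨hδ0.trans hσ.1, hσ.2.le⟩).le) fun σ hσ => by
        have := hE σ ⟨(hδ0.trans hσ.1).le, hσ.2.le⟩
        have h2 : 0 < u σ - u 0 := sub_pos.2 (h.pos_gt ⟨hδ0.trans hσ.1, hσ.2.le⟩)
        have h3 : 2 * c' ≤ 2 * c + σ := by rw [hc']; linarith [hσ.1]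
        nlinarith [mul_le_mul_of_nonneg_right h3 h2.le]
  -- If s is already 8/D at half time, the kernel bound 2/s² leaves at most D/4 to live. Otherwise
  -- the larger coefficient acts on all of [8/D, 8/D + 1], and the uniform gain applies.
  rcases le_or_gt (8 / D) s₁ with hs | hs
  · have h8 : 0 < 8 / D := by positivity
    have h1 := travel_sub_le_two_div (b := √(u L - u 0)) hc'0 (h8.trans_le hs)
      (Real.sqrt_le_sqrt (sub_le_sub_right (h.strictMonoOn_pos.monotoneOn ⟨hδ0.le, hL.le⟩
        (right_mem_Icc.2 (hδ0.trans hL).le) hL.le) _)) (u 0)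
    have h2 : 2 / s₁ ≤ 2 / (8 / D) := by gcongr
    have h3 : 2 / (8 / D) = D / 4 := by field_simp; norm_num
    linarith
  · have h1 := (strictMono_travel_sub_travel hc hcc' (u 0)).monotone hs.le
    have h2 := travel_sub_travel_le_blowup hc hcc' (u 0) (8 / D + 1)
    have h3 := travel_le_blowup hc'0 (u 0) √(u L - u 0)
    have h4 := hgain (u 0)
    linarith

/-- Lifetime of a motion with decreasing coefficient ending in `c`. -/
theorem exists_lifetime_decreasing {c : ℝ} (hc : 0 < c) :
    ∃ ε > 0, ∀ (u p : ℝ → ℝ) (L : ℝ), Flow u p (fun σ => c + (L - σ)) L →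
      L ≤ C / c ^ (1 / 4 : ℝ) - ε := by
  set D := C / c ^ (1 / 4 : ℝ) with hD
  have hDpos : 0 < D := div_pos C_pos (Real.rpow_pos_of_pos hc _)
  set c' := c + D / 4 with hc'
  have hcc' : c < c' := by linarith
  have hc'0 : 0 < c' := hc.trans hcc'
  set S := √(c / 4 * (D / 4) ^ 2) with hS
  have hSpos : 0 < S := by positivity
  obtain ⟨ε, hε, hgain⟩ := exists_uniform_gain (S₁ := 0) (S₂ := S) hc hcc' hSpos
  refine ⟨min ε (D / 2), by positivity, fun u p L h => ?_⟩
  have hm1 := min_le_left ε (D / 2)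
  have hm2 := min_le_right ε (D / 2)
  rcases le_or_gt L (D / 2) with hL | hL
  · linarith
  have hE : ∀ σ ∈ Icc 0 L,
      4 * (u σ ^ 3 - u 0 ^ 3) + (2 * c + 2 * (L - σ)) * (u σ - u 0) ≤ p σ ^ 2 := by
    intro σ hσ
    -- For a decreasing coefficient the current value is itself an effective coefficient; it is at
    -- least `c'` until D/4 before the end.
    refine h.energy_le (g := fun σ => 2 * (L - σ)) (g' := fun _ => 2 * (-1))
      (fun σ _ => ((hasDerivAt_id' σ).const_sub L).const_mul 2) (fun τ hτ => ?_) hσ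
    have := h.pos_gt (Ioo_subset_Ioc_self hτ)
    linarith
  set δ := L - D / 4 with hδ
  have hδ0 : 0 < δ := by linarith
  have hδL : δ < L := by linarith
  set s₁ := √(u δ - u 0) with hs₁
  have ht1 : δ - 0 ≤ travel (u 0) c' s₁ - travel (u 0) c' √(u 0 - u 0) :=
    le_travel_sub hc'0 hδ0.le (h.mono hδL.le).deriv_pos
      (fun σ hσ => h.pos_gt ⟨hσ.1, (hσ.2.trans hδL).le⟩)
      (fun σ hσ => (h.vel_pos ⟨hσ.1, (hσ.2.trans hδL).le⟩).le) fun σ hσ => by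
        have := hE σ ⟨hσ.1.le, (hσ.2.trans hδL).le⟩
        have h2 : 0 < u σ - u 0 := sub_pos.2 (h.pos_gt ⟨hσ.1, (hσ.2.trans hδL).le⟩)
        have h3 : 2 * c' ≤ 2 * c + 2 * (L - σ) := by rw [hc']; linarith [hσ.2]
        nlinarith [mul_le_mul_of_nonneg_right h3 h2.le]
  rw [sub_self, Real.sqrt_zero, travel_zero, sub_zero, sub_zero] at ht1
  have ht2 : L - δ ≤ travel (u 0) c √(u L - u 0) - travel (u 0) c s₁ :=
    le_travel_sub hc hδL.le (fun σ hσ => h.deriv_pos σ ⟨hδ0.le.trans hσ.1, hσ.2⟩)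
      (fun σ hσ => h.pos_gt ⟨hδ0.trans hσ.1, hσ.2.le⟩)
      (fun σ hσ => (h.vel_pos ⟨hδ0.trans hσ.1, hσ.2.le⟩).le) fun σ hσ => by
        have := hE σ ⟨(hδ0.trans hσ.1).le, hσ.2.le⟩
        have h2 : 0 < u σ - u 0 := sub_pos.2 (h.pos_gt ⟨hδ0.trans hσ.1, hσ.2.le⟩)
        nlinarith [mul_nonneg (sub_nonneg.2 hσ.2.le) h2.le]
  -- Since u'' ≥ c, the motion has covered at least cδ²/2 by time δ > D/4, so the larger coefficient
  -- acts on all of [0, S].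
  have hSs : S ≤ s₁ := by
    refine (Real.lt_sqrt hSpos.le).2 ?_ |>.le
    have hmono : MonotoneOn (fun σ => p σ - c * σ) (Icc 0 L) := by
      have hd : ∀ σ ∈ Icc 0 L, HasDerivAt (fun σ => p σ - c * σ)
          (6 * u σ ^ 2 + (c + (L - σ)) - c * 1) σ := fun σ hσ =>
        (h.deriv_vel σ hσ).fun_sub ((hasDerivAt_id' σ).const_mul c)
      refine monotoneOn_of_deriv_nonneg (convex_Icc 0 L)
        (fun σ hσ => (hd σ hσ).continuousAt.continuousWithinAt)
        (fun σ hσ => (hd σ (interior_subset hσ)).differentiableAt.differentiableWithinAt)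
        fun σ hσ => ?_
      rw [(hd σ (interior_subset hσ)).deriv]
      nlinarith [sq_nonneg (u σ), (interior_subset hσ).2]
    have hmono2 : MonotoneOn (fun σ => u σ - c / 2 * σ ^ 2) (Icc 0 L) := by
      have hd : ∀ σ ∈ Icc 0 L, HasDerivAt (fun σ => u σ - c / 2 * σ ^ 2)
          (p σ - c / 2 * (2 * σ)) σ := fun σ hσ => by
        refine (h.deriv_pos σ hσ).fun_sub (HasDerivAt.const_mul (c / 2) ?_)
        simpa using hasDerivAt_pow 2 σ
      refine monotoneOn_of_deriv_nonneg (convex_Icc 0 L)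
        (fun σ hσ => (hd σ hσ).continuousAt.continuousWithinAt)
        (fun σ hσ => (hd σ (interior_subset hσ)).differentiableAt.differentiableWithinAt)
        fun σ hσ => ?_
      have hσ' := interior_subset hσ
      rw [(hd σ hσ').deriv]
      have := hmono (left_mem_Icc.2 (hσ'.1.trans hσ'.2)) hσ' hσ'.1
      simp only at this
      linarith [h.vel_zero]
    have hδm : δ ∈ Icc 0 L := ⟨hδ0.le, hδL.le⟩
    have := hmono2 (left_mem_Icc.2 (hδ0.trans hδL).le) hδm hδ0.le
    simp only at this
    rw [hS, Real.sq_sqrt (by positivity)]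
    have hδD : (D / 4) ^ 2 < δ ^ 2 := by
      have : D / 4 < δ := by linarith
      gcongr
    nlinarith [mul_pos hc (sub_pos.2 hδD), mul_pos hc (pow_pos hδ0 2)]
  have h1 := (strictMono_travel_sub_travel hc hcc' (u 0)).monotone hSs
  have h3 := travel_le_blowup hc (u 0) √(u L - u 0)
  have h4 := hgain (u 0)
  simp only [travel_zero] at h1 h4
  linarith

/-- A motion at rest in `v` with coefficient below `c` stays bounded up to the blow-up time of the
autonomous motion. -/
theorem exists_bound {c δ : ℝ} (hc : 0 < c) (hδ : 0 < δ) (hδL : δ ≤ blowup (u 0) c)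
    (h0 : p 0 = 0) (hk : ∀ σ ∈ Ioo 0 (blowup (u 0) c), k σ < c) (h : Flow u p k δ) :
    ∃ M, ∀ L ∈ Icc 0 (blowup (u 0) c), Flow u p k L → |u L| ≤ M := by
  have hlt : travel (u 0) c √(u δ - u 0) - travel (u 0) c √(u 0 - u 0) < δ - 0 :=
    travel_sub_lt hc hδ h.deriv_pos (fun σ hσ => h.pos_gt (Ioo_subset_Ioc_self hσ))
      fun σ hσ => h.lt_energy h0 (fun τ hτ => hk τ ⟨hτ.1, hτ.2.trans_le hδL⟩)
        (Ioo_subset_Ioc_self hσ)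
  rw [sub_self, Real.sqrt_zero, travel_zero, sub_zero, sub_zero] at hlt
  -- At time δ the motion lags the autonomous one by a fixed amount, and the lag never shrinks.
  -- Hence √(u - u(0)) cannot pass the point `R` beyond which the autonomous motion needs less than
  -- that lag to blow up.
  obtain ⟨R, hR⟩ := ((tendsto_travel hc (u 0)).eventually_const_lt
    (show blowup (u 0) c - (δ - travel (u 0) c √(u δ - u 0)) < blowup (u 0) c by linarith)).exists
  refine ⟨|u 0| + |u δ| + R ^ 2, fun L hL hF => ?_⟩
  have hL0 : u 0 ≤ u L := hF.strictMonoOn_pos.monotoneOn (left_mem_Icc.2 hL.1)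
    (right_mem_Icc.2 hL.1) hL.1
  have hlow : -(|u 0| + |u δ| + R ^ 2) ≤ u L := by
    linarith [neg_abs_le (u 0), abs_nonneg (u δ), sq_nonneg R]
  refine abs_le.2 ⟨hlow, ?_⟩
  rcases le_or_gt L δ with hLδ | hLδ
  · have : u L ≤ u δ := h.strictMonoOn_pos.monotoneOn ⟨hL.1, hLδ⟩ (right_mem_Icc.2 hδ.le) hLδ
    linarith [le_abs_self (u δ), abs_nonneg (u 0), sq_nonneg R]
  · have h2 : travel (u 0) c √(u L - u 0) - travel (u 0) c √(u δ - u 0) < L - δ :=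
      travel_sub_lt hc hLδ (fun σ hσ => hF.deriv_pos σ ⟨hδ.le.trans hσ.1, hσ.2⟩)
        (fun σ hσ => hF.pos_gt ⟨hδ.trans hσ.1, hσ.2.le⟩)
        fun σ hσ => hF.lt_energy h0 (fun τ hτ => hk τ ⟨hτ.1, hτ.2.trans_le hL.2⟩)
          ⟨hδ.trans hσ.1, hσ.2.le⟩
    have h3 : √(u L - u 0) < R := (strictMono_travel hc (u 0)).lt_iff_lt.1
      (by linarith [hL.2])
    have h4 : u L - u 0 < R ^ 2 := (Real.sqrt_lt' ((Real.sqrt_nonneg _).trans_lt h3)).1 h3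
    linarith [le_abs_self (u 0), abs_nonneg (u δ)]

end Flow

/-! ### Solutions of the first Painlevé equation as motions -/

section Solutions

variable {y : ℝ → ℝ} {I : Set ℝ}

theorem SolvesOn.flow_left (h : SolvesOn y I) {x₁ L : ℝ} (hx : x₁ ≤ 0) (hI : Icc (x₁ - L) x₁ ⊆ I)
    (hd : deriv y x₁ ≤ 0) :
    Flow (fun σ => y (x₁ - σ)) (fun σ => -deriv y (x₁ - σ)) (fun σ => -x₁ + σ) L where
  deriv_pos σ hσ := (h.hasDerivAt (hI ⟨by linarith [hσ.2], by linarith [hσ.1]⟩)).comp_const_sub x₁ σ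
  deriv_vel σ hσ := by
    have := ((h.hasDerivAt_deriv (hI ⟨by linarith [hσ.2], by linarith [hσ.1]⟩)).comp_const_sub
      x₁ σ).fun_neg
    refine this.congr_deriv ?_
    ring
  coeff_pos σ hσ := by linarith [hσ.1]
  vel_zero := by simpa using hd

theorem SolvesOn.flow_right (h : SolvesOn y I) {x₁ L : ℝ} (hx : x₁ + L ≤ 0)
    (hI : Icc x₁ (x₁ + L) ⊆ I) (hd : 0 ≤ deriv y x₁) :
    Flow (fun σ => y (x₁ + σ)) (fun σ => deriv y (x₁ + σ)) (fun σ => -x₁ - σ) L where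
  deriv_pos σ hσ := (h.hasDerivAt (hI ⟨by linarith [hσ.1], by linarith [hσ.2]⟩)).comp_const_add x₁ σ
  deriv_vel σ hσ := by
    have := (h.hasDerivAt_deriv (hI ⟨by linarith [hσ.1], by linarith [hσ.2]⟩)).comp_const_add
      x₁ σ
    refine this.congr_deriv ?_
    ring
  coeff_pos σ hσ := by linarith [hσ.2]
  vel_zero := by simpa using hd

theorem IsSolution.exists_Icc_subset (h : IsSolution y I) {x : ℝ} (hx : x ∈ I) {D : ℝ}
    (hD : 0 < D) : ∃ δ, 0 < δ ∧ δ ≤ D ∧ Icc (x - δ) (x + δ) ⊆ I := by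
  obtain ⟨d, hd, hb⟩ := Metric.isOpen_iff.1 h.isOpen x hx
  refine ⟨min (d / 2) D, by positivity, min_le_right _ _, fun t ht => hb ?_⟩
  rw [Real.ball_eq_Ioo]
  have := min_le_left (d / 2) D
  exact ⟨by linarith [ht.1], by linarith [ht.2]⟩

/-- Until the autonomous blow-up time the coefficient -x₁ + σ stays below c, by `hle`; the solution
then remains bounded and continues. -/
theorem IsSolution.left_mem (h : IsSolution y I) {x₁ c : ℝ} (hc : 0 < c) (hx₁ : x₁ ∈ I)
    (hx : x₁ ≤ 0) (hd : deriv y x₁ = 0) (hle : -x₁ + blowup (y x₁) c ≤ c) :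
    x₁ - blowup (y x₁) c ∈ I := by
  have hD := blowup_pos hc (y x₁)
  obtain ⟨δ, hδ, hδD, hsub⟩ := h.exists_Icc_subset hx₁ hD
  have hF := h.solves.flow_left (L := δ) hx
    ((Icc_subset_Icc_right (by linarith)).trans hsub) hd.le
  obtain ⟨M, hM⟩ := hF.exists_bound (c := c) hc hδ (by simpa using hδD) (by simp [hd])
    (fun σ hσ => by simp only [sub_zero] at hσ; linarith [hσ.2])
  simp only [sub_zero] at hM
  refine h.mem_of_bounded (M := M) hx₁ fun x hxI => ?_
  have hx' := hxI.2
  rw [uIcc_of_ge (by linarith)] at hx'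
  have := hM (x₁ - x) ⟨by linarith [hx'.2], by linarith [hx'.1]⟩ (h.solves.flow_left hx
    (by rw [sub_sub_cancel]; exact h.ordConnected.out hxI.1 hx₁) hd.le)
  simpa using this

theorem IsSolution.right_mem (h : IsSolution y I) {x₁ c : ℝ} (hc : 0 < c) (hx₁ : x₁ ∈ I)
    (hx : x₁ + blowup (y x₁) c ≤ 0) (hd : deriv y x₁ = 0) (hle : -x₁ ≤ c) :
    x₁ + blowup (y x₁) c ∈ I := by
  have hD := blowup_pos hc (y x₁)
  obtain ⟨δ, hδ, hδD, hsub⟩ := h.exists_Icc_subset hx₁ hD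
  have hF := h.solves.flow_right (L := δ) (by linarith)
    ((Icc_subset_Icc_left (by linarith)).trans hsub) hd.ge
  obtain ⟨M, hM⟩ := hF.exists_bound (c := c) hc hδ (by simpa using hδD) (by simp [hd])
    (fun σ hσ => by linarith [hσ.1])
  simp only [add_zero] at hM
  refine h.mem_of_bounded (M := M) hx₁ fun x hxI => ?_
  have hx' := hxI.2
  rw [uIcc_of_le (by linarith)] at hx'
  have := hM (x - x₁) ⟨by linarith [hx'.1], by linarith [hx'.2]⟩
    (h.solves.flow_right (by linarith [hx'.2])
    (by rw [add_sub_cancel]; exact h.ordConnected.out hx₁ hxI.1) hd.ge)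
  simpa using this

theorem IsSolution.monotoneOn_deriv (h : IsSolution y I) : MonotoneOn (deriv y) (I ∩ Iic 0) := by
  refine monotoneOn_of_deriv_nonneg (h.ordConnected.inter ordConnected_Iic).convex
    (fun x hx => (h.solves.hasDerivAt_deriv hx.1).continuousAt.continuousWithinAt)
    (fun x hx => (h.solves.hasDerivAt_deriv
      (interior_subset hx).1).differentiableAt.differentiableWithinAt) fun x hx => ?_
  have hx' := interior_subset hx
  rw [(h.solves.hasDerivAt_deriv hx'.1).deriv]
  nlinarith [sq_nonneg (y x), mem_Iic.1 hx'.2]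

/-- By convexity left of 0, y increases away from m in both directions. -/
theorem IsSolution.isMinOn (h : IsSolution y I) {m x₀ : ℝ} (hm : m ∈ I) (hm0 : m ≤ 0)
    (hx₀ : x₀ ≤ 0) (hd : deriv y m = 0) : IsMinOn y (I ∩ Iic x₀) m := by
  rintro x ⟨hxI, hx⟩
  rcases lt_trichotomy x m with hxm | rfl | hxm
  · have := (h.solves.flow_left (L := m - x) hm0
      (by rw [sub_sub_cancel]; exact h.ordConnected.out hxI hm) hd.le).pos_gt
      (σ := m - x) ⟨by linarith, le_rfl⟩
    simp only [sub_zero, sub_sub_cancel] at this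
    exact this.le
  · exact le_refl (y x)
  · have := (h.solves.flow_right (L := x - m) (by linarith [mem_Iic.1 hx])
      (by rw [add_sub_cancel]; exact h.ordConnected.out hm hxI) hd.ge).pos_gt
      (σ := x - m) ⟨by linarith, le_rfl⟩
    simp only [add_zero, add_sub_cancel] at this
    exact this.le

theorem IsSolution.deriv_eq_zero_of_isMinOn (h : IsSolution y I) {m x₀ : ℝ} (hm : m ∈ I)
    (hmx : m < x₀) (hmin : IsMinOn y (I ∩ Iic x₀) m) : deriv y m = 0 :=
  (hmin.isLocalMin (inter_mem (h.isOpen.mem_nhds hm) (Iic_mem_nhds hmx))).deriv_eq_zero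

/-- Left of `x₁ ≤ 0`, a solution with positive slope at `x₁` has a critical point. -/
theorem IsSolution.exists_deriv_eq_zero (h : IsSolution y I) {x₁ : ℝ} (hx₁ : x₁ ∈ I)
    (hx : x₁ ≤ 0) (hd : 0 < deriv y x₁) : ∃ m ∈ I, m < x₁ ∧ deriv y m = 0 := by
  by_contra! hcon
  have hpos : ∀ x ∈ I, x ≤ x₁ → 0 < deriv y x := by
    intro x hxI hxx
    by_contra! hneg
    have hcont : ContinuousOn (deriv y) (Icc x x₁) := fun t ht =>
      (h.solves.hasDerivAt_deriv (h.ordConnected.out hxI hx₁ ht)).continuousAt.continuousWithinAt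
    obtain ⟨m, hm, hm0⟩ := intermediate_value_Icc hxx hcont ⟨hneg, hd.le⟩
    have hmne : m ≠ x₁ := fun he => hd.ne' (he ▸ hm0)
    exact hcon m (h.ordConnected.out hxI hx₁ hm) (lt_of_le_of_ne hm.2 hmne) hm0
  -- With 0 < y' ≤ y'(x₁) the solution stays bounded as far as `x₂`. But y' + x²/2 has derivative
  -- 6y² ≥ 0, so y'(x₂) ≤ A - x₂²/2, which is negative because x₂² ≥ (1 + 2A)².
  set A := deriv y x₁ + x₁ ^ 2 / 2 with hA
  have hApos : 0 < A := by positivity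
  set x₂ := x₁ - (1 + 2 * A) with hx₂
  have hmem : x₂ ∈ I := by
    refine h.mem_of_bounded (M := |y x₁| + deriv y x₁ * (1 + 2 * A)) hx₁ fun x hxI => ?_
    have hx' := hxI.2
    rw [uIcc_of_ge (by linarith)] at hx'
    have := (convex_Icc x x₁).norm_image_sub_le_of_norm_hasDerivWithin_le (f := y)
      (f' := deriv y) (C := deriv y x₁)
      (fun t ht => (h.solves.hasDerivAt (h.ordConnected.out hxI.1 hx₁ ht)).hasDerivWithinAt)
      (fun t ht => by
        have htI := h.ordConnected.out hxI.1 hx₁ ht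
        rw [Real.norm_of_nonneg (hpos t htI ht.2).le]
        exact h.monotoneOn_deriv ⟨htI, ht.2.trans hx⟩ ⟨hx₁, hx⟩ ht.2)
      (right_mem_Icc.2 hx'.2) (left_mem_Icc.2 hx'.2)
    rw [Real.norm_eq_abs, Real.norm_eq_abs, abs_sub_comm x, abs_of_nonneg (sub_nonneg.2 hx'.2)]
      at this
    have h2 : deriv y x₁ * (x₁ - x) ≤ deriv y x₁ * (1 + 2 * A) :=
      mul_le_mul_of_nonneg_left (by linarith [hx'.1]) hd.le
    linarith [abs_sub_abs_le_abs_sub (y x) (y x₁)]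
  have hmono : MonotoneOn (fun x => deriv y x + x ^ 2 / 2) (Icc x₂ x₁) := by
    have hD : ∀ x ∈ Icc x₂ x₁, HasDerivAt (fun x => deriv y x + x ^ 2 / 2)
        (6 * y x ^ 2 - x + x) x := fun x hx => by
      refine (h.solves.hasDerivAt_deriv (h.ordConnected.out hmem hx₁ hx)).fun_add ?_
      have := (hasDerivAt_pow 2 x).div_const 2
      simpa using this
    refine monotoneOn_of_deriv_nonneg (convex_Icc _ _)
      (fun x hx => (hD x hx).continuousAt.continuousWithinAt)
      (fun x hx => (hD x (interior_subset hx)).differentiableAt.differentiableWithinAt)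
      fun x hx => ?_
    rw [(hD x (interior_subset hx)).deriv]
    nlinarith [sq_nonneg (y x)]
  have hx21 : x₂ ≤ x₁ := by linarith
  have h1 := hmono (left_mem_Icc.2 hx21) (right_mem_Icc.2 hx21) hx21
  have h2 := hpos x₂ hmem hx21
  simp only at h1
  nlinarith [mul_nonneg (neg_nonneg.2 hx) hApos.le]

theorem IsSolution.leftEnd_lt (h : IsSolution y I) {x : ℝ} (hx : x ∈ I) : leftEnd I < x := by
  obtain ⟨δ, hδ, -, hsub⟩ := h.exists_Icc_subset hx one_pos
  refine (iInf₂_le (x - δ) (hsub (left_mem_Icc.2 (by linarith)))).trans_lt ?_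
  exact_mod_cast sub_lt_self x hδ

theorem coe_le_leftEnd {r : ℝ} (h : ∀ x ∈ I, r ≤ x) : (r : EReal) ≤ leftEnd I :=
  le_iInf₂ fun x hx => by exact_mod_cast h x hx

end Solutions

/-! ### The extremal left endpoints -/

theorem exists_le_of_deriv_nonpos {x₀ : ℝ} (hx₀ : x₀ < 0) :
    ∃ ε > 0, ∀ (y : ℝ → ℝ) (I : Set ℝ), IsSolution y I → x₀ ∈ I → deriv y x₀ ≤ 0 →
      ∀ x ∈ I, x₀ - C / |x₀| ^ (1 / 4 : ℝ) + ε ≤ x := by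
  obtain ⟨ε, hε, H⟩ := Flow.exists_lifetime_increasing (neg_pos.2 hx₀)
  refine ⟨ε, hε, fun y I h hI hd x hx => ?_⟩
  rw [abs_of_neg hx₀]
  -- Points to the right of x₀ are covered by a motion of length zero.
  have key : max (x₀ - x) 0 ≤ C / (-x₀) ^ (1 / 4 : ℝ) - ε := by
    refine H _ _ _ (h.solves.flow_left (L := max (x₀ - x) 0) hx₀.le ?_ hd)
    rcases le_total (x₀ - x) 0 with h' | h'
    · rw [max_eq_right h', sub_zero, Icc_self, singleton_subset_iff]
      exact hI
    · rw [max_eq_left h', sub_sub_cancel]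
      exact h.ordConnected.out hx hI
  linarith [le_max_left (x₀ - x) 0]

theorem exists_le_of_critical {x₀ : ℝ} (hx₀ : x₀ < 0) :
    ∃ ε > 0, ∀ (y : ℝ → ℝ) (I : Set ℝ) (m : ℝ), IsSolution y I → x₀ ∈ I → m ∈ I → m < x₀ →
      deriv y m = 0 → x₀ - C / |x₀| ^ (1 / 4 : ℝ) + ε ≤ m := by
  obtain ⟨ε, hε, H⟩ := Flow.exists_lifetime_decreasing (neg_pos.2 hx₀)
  refine ⟨ε, hε, fun y I m h hI hm hmx hd => ?_⟩
  rw [abs_of_neg hx₀]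
  have hF := h.solves.flow_right (x₁ := m) (L := x₀ - m) (by linarith)
    (by rw [add_sub_cancel]; exact h.ordConnected.out hm hI) hd.ge
  rw [show (fun σ => -m - σ) = fun σ => -x₀ + (x₀ - m - σ) by funext σ; ring] at hF
  linarith [H _ _ _ hF]

theorem exists_coe_le_extXminus {x₀ : ℝ} (hx₀ : x₀ < 0) :
    ∃ ε > 0, ((x₀ - C / |x₀| ^ (1 / 4 : ℝ) + ε : ℝ) : EReal) ≤ extXminus x₀ := by
  obtain ⟨ε, hε, H⟩ := exists_le_of_deriv_nonpos hx₀
  refine ⟨ε, hε, le_sInf ?_⟩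
  rintro _ ⟨y, I, h, hI, hd, rfl⟩
  exact coe_le_leftEnd (H y I h hI hd)

theorem exists_coe_le_extXmin {x₀ : ℝ} (hx₀ : x₀ < 0) :
    ∃ ε > 0, ((x₀ - C / |x₀| ^ (1 / 4 : ℝ) + ε : ℝ) : EReal) ≤ extXmin x₀ := by
  obtain ⟨ε, hε, H⟩ := exists_le_of_critical hx₀
  refine ⟨ε, hε, le_sInf ?_⟩
  rintro _ ⟨y, I, m, h, hI, hd, hm, hmx, hmin, rfl⟩
  exact_mod_cast H y I m h hI hm hmx (h.deriv_eq_zero_of_isMinOn hm hmx hmin)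

theorem extXminus_bddBelow {x₀ : ℝ} (hx₀ : x₀ ≤ 0) : ∃ r : ℝ, (r : EReal) ≤ extXminus x₀ := by
  -- At x₀ = 0 the comparison coefficient vanishes, so the base point is moved to x₀ - 1; convexity
  -- preserves the sign of the slope there.
  obtain ⟨ε, -, H⟩ := exists_le_of_deriv_nonpos (show x₀ - 1 < 0 by linarith)
  refine ⟨min (x₀ - 1) (x₀ - 1 - C / |x₀ - 1| ^ (1 / 4 : ℝ) + ε), le_sInf ?_⟩
  rintro _ ⟨y, I, h, hI, hd, rfl⟩
  refine coe_le_leftEnd fun x hx => ?_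
  rcases le_or_gt (x₀ - 1) x with h' | h'
  · exact (min_le_left _ _).trans h'
  · have hmem := h.ordConnected.out hx hI ⟨h'.le, by linarith⟩
    exact (min_le_right _ _).trans (H y I h hmem ((h.monotoneOn_deriv ⟨hmem, by simp; linarith⟩
      ⟨hI, hx₀⟩ (by linarith)).trans hd) x hx)

theorem extXmin_bddBelow {x₀ : ℝ} (hx₀ : x₀ ≤ 0) : ∃ r : ℝ, (r : EReal) ≤ extXmin x₀ := by
  obtain ⟨ε, -, H⟩ := exists_le_of_critical (show x₀ - 1 < 0 by linarith)
  refine ⟨min (x₀ - 1) (x₀ - 1 - C / |x₀ - 1| ^ (1 / 4 : ℝ) + ε), le_sInf ?_⟩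
  rintro _ ⟨y, I, m, h, hI, hd, hm, hmx, hmin, rfl⟩
  rw [EReal.coe_le_coe_iff]
  rcases le_or_gt (x₀ - 1) m with h' | h'
  · exact (min_le_left _ _).trans h'
  · exact (min_le_right _ _).trans (H y I m h (h.ordConnected.out hm hI ⟨h'.le, by linarith⟩) hm h'
      (h.deriv_eq_zero_of_isMinOn hm hmx hmin))

theorem extXminus_lt (x₀ : ℝ) : extXminus x₀ < x₀ := by
  obtain ⟨y, I, h, hI, -, hd⟩ := exists_isSolution x₀ 0 0
  have : extXminus x₀ ≤ leftEnd I := sInf_le ⟨y, I, h, hI, hd.le, rfl⟩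
  exact this.trans_lt (h.leftEnd_lt hI)

/-- Release the optimal motion for coefficient t at rest at -t: to the right the coefficient falls
below t, so it survives for the time C/t^(1/4). -/
theorem extXmin_le {t : ℝ} (ht : 0 < t) (ht0 : 0 ≤ t - C / t ^ (1 / 4 : ℝ)) :
    extXmin (-(t - C / t ^ (1 / 4 : ℝ))) ≤ ((-t : ℝ) : EReal) := by
  obtain ⟨v, hv⟩ := exists_blowup_eq ht
  have hD : 0 < C / t ^ (1 / 4 : ℝ) := hv ▸ blowup_pos ht v
  obtain ⟨y, I, h, hI, hyv, hd⟩ := exists_isSolution (-t) v 0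
  rw [← hyv] at hv
  have hmem := h.right_mem ht hI (by linarith) hd (by linarith)
  rw [hv, show -t + C / t ^ (1 / 4 : ℝ) = -(t - C / t ^ (1 / 4 : ℝ)) by ring] at hmem
  have hlt : -t < -(t - C / t ^ (1 / 4 : ℝ)) := by linarith
  refine sInf_le ⟨y, I, -t, h, hmem, ?_, hI, hlt, h.isMinOn hI (by linarith) (by linarith) hd, rfl⟩
  rw [← hd]
  exact h.monotoneOn_deriv ⟨hI, by simp; linarith⟩ ⟨hmem, by simp; linarith⟩ hlt.le

/-- Released at rest at the midpoint -t + D, the motion meets coefficients at most t on both sides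
and survives for the time D each way. Openness of `I` at -t gives strictness. -/
theorem extX_lt {t : ℝ} (ht : 0 < t) (ht0 : 0 ≤ t - 2 * (C / t ^ (1 / 4 : ℝ))) :
    extX (-(t - 2 * (C / t ^ (1 / 4 : ℝ)))) < ((-t : ℝ) : EReal) := by
  obtain ⟨v, hv⟩ := exists_blowup_eq ht
  set D := C / t ^ (1 / 4 : ℝ) with hDdef
  have hD : 0 < D := hv ▸ blowup_pos ht v
  obtain ⟨y, I, h, hI, hyv, hd⟩ := exists_isSolution (-t + D) v 0
  rw [← hyv] at hv
  have hr := h.right_mem ht hI (by linarith) hd (by linarith)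
  have hl := h.left_mem ht hI (by linarith) hd (by linarith)
  rw [hv, show -t + D + D = -(t - 2 * D) by ring] at hr
  rw [hv, show -t + D - D = -t by ring] at hl
  have : extX (-(t - 2 * D)) ≤ leftEnd I := sInf_le ⟨y, I, h, hr, rfl⟩
  exact this.trans_lt (h.leftEnd_lt hl)

/-- A positive slope at r would force a critical point left of r; by convexity it would be a
minimum, contradicting the choice of r. A solution not regular at r ends no further left than r. -/
theorem extXminus_le_extX {x₀ r : ℝ} (hx₀ : x₀ ≤ 0) (hr : extXmin x₀ = r) (hrx : r < x₀) :
    extXminus r ≤ extX x₀ := by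
  refine le_sInf ?_
  rintro _ ⟨y, I, h, hI, rfl⟩
  by_cases hrI : r ∈ I
  · refine sInf_le ⟨y, I, h, hrI, ?_, rfl⟩
    by_contra! hd
    obtain ⟨m, hm, hmr, hd0⟩ := h.exists_deriv_eq_zero hrI (by linarith) hd
    have : extXmin x₀ ≤ (m : EReal) := by
      refine sInf_le ⟨y, I, m, h, hI, ?_, hm, hmr.trans hrx,
        h.isMinOn hm (by linarith) hx₀ hd0, rfl⟩
      exact hd.le.trans (h.monotoneOn_deriv ⟨hrI, by simp; linarith⟩ ⟨hI, hx₀⟩ hrx.le)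
    rw [hr, EReal.coe_le_coe_iff] at this
    linarith
  · refine (extXminus_lt r).le.trans (coe_le_leftEnd fun x hx => ?_)
    by_contra! hxr
    exact hrI (h.ordConnected.out hx hI ⟨hxr.le, hrx.le⟩)

/-! ### The root `eta` -/

/-- At a positive root of h(h⁴ - a) = C both factors are positive, and from there on they increase,
so no second root exists. -/
theorem exists_etaRoots_eq (x₀ : ℝ) : ∃ h, etaRoots x₀ = {h} := by
  have ha := abs_nonneg x₀
  have hC := C_pos
  set a := |x₀| with hadef
  set N := 1 + a + C with hN
  have hN1 : 1 ≤ N := by linarith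
  obtain ⟨h, ⟨hh0, -⟩, hh⟩ := intermediate_value_Icc (f := fun h : ℝ => h ^ 5 - a * h)
    (show (0 : ℝ) ≤ N by linarith) (by fun_prop) (show C ∈ Icc _ _ by
      refine ⟨by simpa using hC.le, ?_⟩
      have h4 : N ≤ N ^ 4 := le_self_pow₀ hN1 (by norm_num)
      have : C ≤ N * (N ^ 4 - a) := by nlinarith
      calc C ≤ N * (N ^ 4 - a) := this
        _ = N ^ 5 - a * N := by ring)
  simp only at hh
  have hhpos : 0 < h := lt_of_le_of_ne hh0 fun h0 => by
    rw [← h0] at hh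
    norm_num at hh
    linarith
  have hlt : ∀ p q : ℝ, 0 < p → p ^ 5 - a * p = C → p < q → C < q ^ 5 - a * q := by
    intro p q hp hpC hpq
    have h1 : 0 < p ^ 4 - a := by
      have : 0 < p * (p ^ 4 - a) := by linarith [show p * (p ^ 4 - a) = p ^ 5 - a * p by ring]
      exact (pos_iff_pos_of_mul_pos this).1 hp
    have h2 : p ^ 4 < q ^ 4 := by gcongr
    calc C = p * (p ^ 4 - a) := by linarith
      _ < q * (q ^ 4 - a) := by
        refine mul_lt_mul hpq (by linarith) h1 (hp.trans hpq).le
      _ = q ^ 5 - a * q := by ring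
  refine ⟨h, Set.eq_singleton_iff_unique_mem.2 ⟨⟨hhpos, hh⟩, ?_⟩⟩
  rintro h' ⟨h'pos, hh'⟩
  rcases lt_trichotomy h' h with hl | he | hl
  · exact absurd hh (hlt h' h h'pos hh' hl).ne'
  · exact he
  · exact absurd hh' (hlt h h' hhpos hh hl).ne'

theorem etaRoots_eq (x₀ : ℝ) : etaRoots x₀ = {eta x₀} := by
  obtain ⟨h, hh⟩ := exists_etaRoots_eq x₀
  rw [eta, hh, csSup_singleton]

theorem eta_mem (x₀ : ℝ) : eta x₀ ∈ etaRoots x₀ := by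
  rw [etaRoots_eq]
  exact mem_singleton _

theorem eta_pos (x₀ : ℝ) : 0 < eta x₀ := (eta_mem x₀).1

theorem eta_pow_sub (x₀ : ℝ) : eta x₀ ^ 4 - C / eta x₀ = |x₀| := by
  have h := (eta_mem x₀).2
  have hp := (eta_pos x₀).ne'
  field_simp
  linarith

theorem abs_lt_eta_pow (x₀ : ℝ) : |x₀| < eta x₀ ^ 4 := by
  have := eta_pow_sub x₀
  have := div_pos C_pos (eta_pos x₀)
  linarith

theorem rpow_quarter_of_pow {h : ℝ} (hh : 0 ≤ h) : (h ^ 4) ^ (1 / 4 : ℝ) = h := by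
  rw [← Real.rpow_natCast, ← Real.rpow_mul hh]
  norm_num

theorem abs_rpow_quarter_lt_eta (x₀ : ℝ) : |x₀| ^ (1 / 4 : ℝ) < eta x₀ := by
  have := Real.rpow_lt_rpow (abs_nonneg x₀) (abs_lt_eta_pow x₀) (show (0 : ℝ) < 1 / 4 by norm_num)
  rwa [rpow_quarter_of_pow (eta_pos x₀).le] at this

/-! ### Finiteness and bounds for the extremal endpoints -/

theorem eq_coe_toReal {a : EReal} {r s : ℝ} (hr : (r : EReal) ≤ a) (hs : a ≤ s) :
    a = (a.toReal : EReal) :=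
  (EReal.coe_toReal (ne_top_of_le_ne_top (EReal.coe_ne_top s) hs)
    (ne_bot_of_le_ne_bot (EReal.coe_ne_bot r) hr)).symm

theorem extXmin_le_eta {x₀ : ℝ} (hx₀ : x₀ ≤ 0) :
    extXmin x₀ ≤ ((-eta x₀ ^ 4 : ℝ) : EReal) := by
  have hp := eta_pos x₀
  have hq := rpow_quarter_of_pow hp.le
  have hs := eta_pow_sub x₀
  have := extXmin_le (t := eta x₀ ^ 4) (by positivity) (by rw [hq, hs]; exact abs_nonneg _)
  rwa [hq, hs, abs_of_nonpos hx₀, neg_neg] at this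

theorem extXmin_eq {x₀ : ℝ} (hx₀ : x₀ ≤ 0) : extXmin x₀ = (Xmin x₀ : EReal) := by
  obtain ⟨r, hr⟩ := extXmin_bddBelow hx₀
  exact eq_coe_toReal hr (extXmin_le_eta hx₀)

theorem extXminus_eq {x₀ : ℝ} (hx₀ : x₀ ≤ 0) : extXminus x₀ = (Xminus x₀ : EReal) := by
  obtain ⟨r, hr⟩ := extXminus_bddBelow hx₀
  exact eq_coe_toReal hr (extXminus_lt x₀).le

theorem Xmin_le {x₀ : ℝ} (hx₀ : x₀ ≤ 0) : Xmin x₀ ≤ -eta x₀ ^ 4 := by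
  have := extXmin_le_eta hx₀
  rwa [extXmin_eq hx₀, EReal.coe_le_coe_iff] at this

theorem Xmin_lt {x₀ : ℝ} (hx₀ : x₀ ≤ 0) : Xmin x₀ < x₀ := by
  have h1 := Xmin_le hx₀
  have h2 := abs_lt_eta_pow x₀
  rw [abs_of_nonpos hx₀] at h2
  linarith

theorem lt_Xmin {x₀ : ℝ} (hx₀ : x₀ < 0) : x₀ - C / |x₀| ^ (1 / 4 : ℝ) < Xmin x₀ := by
  obtain ⟨ε, hε, h⟩ := exists_coe_le_extXmin hx₀
  rw [extXmin_eq hx₀.le, EReal.coe_le_coe_iff] at h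
  linarith

theorem lt_Xminus {x₀ : ℝ} (hx₀ : x₀ < 0) : x₀ - C / |x₀| ^ (1 / 4 : ℝ) < Xminus x₀ := by
  obtain ⟨ε, hε, h⟩ := exists_coe_le_extXminus hx₀
  rw [extXminus_eq hx₀.le, EReal.coe_le_coe_iff] at h
  linarith

theorem eta_le_Xmin_rpow {x₀ : ℝ} (hx₀ : x₀ ≤ 0) : eta x₀ ≤ |Xmin x₀| ^ (1 / 4 : ℝ) := by
  have hp := eta_pos x₀
  have h1 := Xmin_le hx₀
  have h2 : eta x₀ ^ 4 ≤ |Xmin x₀| := by linarith [neg_abs_le (Xmin x₀)]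
  have := Real.rpow_le_rpow (by positivity) h2 (show (0 : ℝ) ≤ 1 / 4 by norm_num)
  rwa [rpow_quarter_of_pow hp.le] at this

theorem coe_Xminus_Xmin_le {x₀ : ℝ} (hx₀ : x₀ ≤ 0) :
    (Xminus (Xmin x₀) : EReal) ≤ extX x₀ := by
  have hlt := Xmin_lt hx₀
  rw [← extXminus_eq (hlt.le.trans hx₀)]
  exact extXminus_le_extX hx₀ (extXmin_eq hx₀) hlt

/-- `2 ^ (4 / 5)` through the fifth root of two. -/
theorem exists_fifth_root_two :
    ∃ q : ℝ, 0 < q ∧ (2 : ℝ) ^ (4 / 5 : ℝ) = q ^ 4 ∧ q ^ 5 = 2 := by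
  refine ⟨2 ^ (1 / 5 : ℝ), by positivity, ?_, ?_⟩ <;>
  · rw [← Real.rpow_natCast, ← Real.rpow_mul (by norm_num)]
    norm_num

/-- With q⁵ = 2 and e = `eta (x₀ / q ^ 4)`, multiplying e⁴ - C/e = |x₀|/q⁴ by q⁴ = 2/q shows that t
= (qe)⁴ solves t - 2C/t^(1/4) = |x₀|. -/
theorem extX_lt_eta {x₀ : ℝ} (hx₀ : x₀ ≤ 0) :
    extX x₀ < ((x₀ - (2 : ℝ) ^ (4 / 5 : ℝ) * C / eta (x₀ / (2 : ℝ) ^ (4 / 5 : ℝ)) : ℝ) : EReal) := by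
  obtain ⟨q, hq, hq4, hq5⟩ := exists_fifth_root_two
  rw [hq4]
  have hp := eta_pos (x₀ / q ^ 4)
  have hs := eta_pow_sub (x₀ / q ^ 4)
  rw [abs_div, abs_of_pos (pow_pos hq 4), abs_of_nonpos hx₀] at hs
  set e := eta (x₀ / q ^ 4) with he
  have ht : ((q * e) ^ 4) ^ (1 / 4 : ℝ) = q * e := rpow_quarter_of_pow (by positivity)
  have hdiv : 2 * (C / (q * e)) = q ^ 4 * C / e := by
    rw [← hq5]; field_simp
  have hx : (q * e) ^ 4 - 2 * (C / (q * e)) = -x₀ := by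
    rw [hdiv]
    have : (q * e) ^ 4 - q ^ 4 * C / e = q ^ 4 * (e ^ 4 - C / e) := by ring
    rw [this, hs]
    field_simp
  have h := extX_lt (t := (q * e) ^ 4) (by positivity) (by rw [ht, hx]; linarith)
  rw [ht, hx, neg_neg] at h
  rwa [show x₀ - q ^ 4 * C / e = -(q * e) ^ 4 by rw [← hdiv]; linarith]

theorem extX_eq {x₀ : ℝ} (hx₀ : x₀ ≤ 0) : extX x₀ = (X x₀ : EReal) :=
  eq_coe_toReal (coe_Xminus_Xmin_le hx₀) (extX_lt_eta hx₀).le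

theorem Xminus_Xmin_le_X {x₀ : ℝ} (hx₀ : x₀ ≤ 0) : Xminus (Xmin x₀) ≤ X x₀ := by
  have := coe_Xminus_Xmin_le hx₀
  rwa [extX_eq hx₀, EReal.coe_le_coe_iff] at this

theorem X_lt_eta {x₀ : ℝ} (hx₀ : x₀ ≤ 0) :
    X x₀ < x₀ - (2 : ℝ) ^ (4 / 5 : ℝ) * C / eta (x₀ / (2 : ℝ) ^ (4 / 5 : ℝ)) := by
  have := extX_lt_eta hx₀
  rwa [extX_eq hx₀, EReal.coe_lt_coe_iff] at this

theorem lt_Xmin_sub {x₀ : ℝ} (hx₀ : x₀ < 0) :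
    x₀ - C / |x₀| ^ (1 / 4 : ℝ) - C / eta x₀ < Xmin x₀ - C / |Xmin x₀| ^ (1 / 4 : ℝ) := by
  have h1 := lt_Xmin hx₀
  have h2 : C / |Xmin x₀| ^ (1 / 4 : ℝ) ≤ C / eta x₀ :=
    div_le_div_of_nonneg_left C_pos.le (eta_pos x₀) (eta_le_Xmin_rpow hx₀.le)
  linarith

theorem Xmin_sub_lt_X {x₀ : ℝ} (hx₀ : x₀ < 0) :
    Xmin x₀ - C / |Xmin x₀| ^ (1 / 4 : ℝ) < X x₀ :=
  (lt_Xminus ((Xmin_lt hx₀.le).trans hx₀)).trans_le (Xminus_Xmin_le_X hx₀.le)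

theorem X_lt_Xmin {x₀ : ℝ} (hx₀ : x₀ < 0) :
    X x₀ < x₀ - (2 : ℝ) ^ (4 / 5 : ℝ) * C / |Xmin (x₀ / (2 : ℝ) ^ (4 / 5 : ℝ))| ^ (1 / 4 : ℝ) := by
  have hb : (0 : ℝ) < (2 : ℝ) ^ (4 / 5 : ℝ) := by positivity
  refine (X_lt_eta hx₀.le).trans_le (sub_le_sub_left ?_ _)
  exact div_le_div_of_nonneg_left (mul_pos hb C_pos).le (eta_pos _)
    (eta_le_Xmin_rpow (div_neg_of_neg_of_pos hx₀ hb).le)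

/-- This is `lt_Xmin` at x₀/q⁴: the fourth root releases a factor q, and q⁵ = 2. -/
theorem two_mul_C_div_lt {x₀ : ℝ} (hx₀ : x₀ < 0) :
    x₀ - (2 : ℝ) ^ (4 / 5 : ℝ) * C / |Xmin (x₀ / (2 : ℝ) ^ (4 / 5 : ℝ))| ^ (1 / 4 : ℝ) <
      x₀ - 2 * C / |(|x₀| + 2 * C / |x₀| ^ (1 / 4 : ℝ))| ^ (1 / 4 : ℝ) := by
  obtain ⟨q, hq, hq4, hq5⟩ := exists_fifth_root_two
  rw [hq4]
  have hC := C_pos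
  have ha : 0 < |x₀| := abs_pos.2 hx₀.ne
  have hw : x₀ / q ^ 4 < 0 := div_neg_of_neg_of_pos hx₀ (by positivity)
  have hw4 : |x₀ / q ^ 4| ^ (1 / 4 : ℝ) = |x₀| ^ (1 / 4 : ℝ) / q := by
    rw [abs_div, abs_of_pos (pow_pos hq 4), Real.div_rpow ha.le (by positivity),
      rpow_quarter_of_pow hq.le]
  have h1 := lt_Xmin hw
  rw [hw4] at h1
  have hneg := (Xmin_lt hw.le).trans hw
  have hr : 0 < |x₀| ^ (1 / 4 : ℝ) := Real.rpow_pos_of_pos ha _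
  set Y := |x₀| + 2 * C / |x₀| ^ (1 / 4 : ℝ) with hY
  have hYpos : 0 < Y := by positivity
  rw [abs_of_pos hYpos]
  have h2 : |Xmin (x₀ / q ^ 4)| < Y / q ^ 4 := by
    rw [abs_of_neg hneg]
    have : Y / q ^ 4 = -(x₀ / q ^ 4 - C / (|x₀| ^ (1 / 4 : ℝ) / q)) := by
      rw [hY, ← hq5, abs_of_neg hx₀]
      rw [abs_of_neg hx₀] at hr
      field_simp
      ring
    linarith
  have h3 := Real.rpow_lt_rpow (abs_nonneg _) h2 (show (0 : ℝ) < 1 / 4 by norm_num)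
  rw [Real.div_rpow hYpos.le (by positivity), rpow_quarter_of_pow hq.le] at h3
  have hXpos : 0 < |Xmin (x₀ / q ^ 4)| ^ (1 / 4 : ℝ) :=
    Real.rpow_pos_of_pos (abs_pos.2 hneg.ne) _
  have hY4 : 0 < Y ^ (1 / 4 : ℝ) := Real.rpow_pos_of_pos hYpos _
  refine sub_lt_sub_left ?_ _
  calc 2 * C / Y ^ (1 / 4 : ℝ) = q ^ 4 * C / (Y ^ (1 / 4 : ℝ) / q) := by
        rw [← hq5]; field_simp
    _ < _ := div_lt_div_of_pos_left (by positivity) hXpos h3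

/-! ### The error term -/

theorem error_pos {x₀ : ℝ} (hx₀ : x₀ < 0) :
    0 < X x₀ - (x₀ - 2 * C / |x₀| ^ (1 / 4 : ℝ)) := by
  have h1 := (lt_Xmin_sub hx₀).trans (Xmin_sub_lt_X hx₀)
  have h2 : C / eta x₀ < C / |x₀| ^ (1 / 4 : ℝ) :=
    div_lt_div_of_pos_left C_pos (Real.rpow_pos_of_pos (abs_pos.2 hx₀.ne) _)
      (abs_rpow_quarter_lt_eta x₀)
  have h3 : 2 * C / |x₀| ^ (1 / 4 : ℝ) = C / |x₀| ^ (1 / 4 : ℝ) + C / |x₀| ^ (1 / 4 : ℝ) := by ring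
  linarith

theorem error_lt {x₀ : ℝ} (hx₀ : x₀ < 0) :
    X x₀ - (x₀ - 2 * C / |x₀| ^ (1 / 4 : ℝ)) < C ^ 2 / |x₀| ^ (3 / 2 : ℝ) := by
  have h1 := (X_lt_Xmin hx₀).trans (two_mul_C_div_lt hx₀)
  have hC := C_pos
  have ha : 0 < |x₀| := abs_pos.2 hx₀.ne
  have hh : 0 < |x₀| ^ (1 / 4 : ℝ) := Real.rpow_pos_of_pos ha _
  have h6 : |x₀| ^ (3 / 2 : ℝ) = (|x₀| ^ (1 / 4 : ℝ)) ^ 6 := by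
    rw [← Real.rpow_natCast, ← Real.rpow_mul ha.le]
    norm_num
  have h4 := rpow_quarter_pow ha.le
  rw [h6]
  set h := |x₀| ^ (1 / 4 : ℝ)
  set Y := |x₀| + 2 * C / h with hY
  have hYpos : 0 < Y := by positivity
  rw [abs_of_pos hYpos] at h1
  have hY4 := rpow_quarter_pow hYpos.le
  have hZ : 0 < Y ^ (1 / 4 : ℝ) := Real.rpow_pos_of_pos hYpos _
  set Z := Y ^ (1 / 4 : ℝ)
  suffices 2 * C / h - 2 * C / Z ≤ C ^ 2 / h ^ 6 by linarith
  have hCZ : C = h * (Z ^ 4 - h ^ 4) / 2 := by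
    rw [hY4, h4, hY]
    field_simp
    ring
  -- This is the tangent line inequality for z ↦ z^(-1/4) at z = h⁴, with the remainder in closed
  -- form; strictness comes from `h1`.
  have hdiff : C ^ 2 / h ^ 6 - (2 * C / h - 2 * C / Z) =
      C / (2 * h ^ 5 * Z) * ((Z - h) ^ 2 * (Z ^ 3 + 2 * Z ^ 2 * h + 3 * Z * h ^ 2 + 4 * h ^ 3)) := by
    have : C ^ 2 / h ^ 6 = C * (h * (Z ^ 4 - h ^ 4) / 2) / h ^ 6 := by rw [← hCZ, sq]
    rw [this]
    field_simp
    ring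
  have : 0 ≤ C / (2 * h ^ 5 * Z) *
      ((Z - h) ^ 2 * (Z ^ 3 + 2 * Z ^ 2 * h + 3 * Z * h ^ 2 + 4 * h ^ 3)) := by positivity
  linarith

theorem isBigO_error :
    (fun x₀ : ℝ => X x₀ - (x₀ - 2 * C / |x₀| ^ (1 / 4 : ℝ)))
      =O[atBot] (fun x₀ : ℝ => 1 / |x₀| ^ (3 / 2 : ℝ)) := by
  refine Asymptotics.IsBigO.of_bound (C ^ 2) ?_
  filter_upwards [eventually_lt_atBot 0] with x hx
  rw [Real.norm_of_nonneg (error_pos hx).le, Real.norm_of_nonneg (by positivity), mul_one_div]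
  exact (error_lt hx).le

end PainleveOne

theorem theorem2p1 :
    -- `C` is a maximum
    IsGreatest (PainleveOne.integralI '' Set.Iio 0) PainleveOne.C ∧
    (∀ x₀ : ℝ, x₀ ≤ 0 →
      -- `eta x₀` is the unique positive root
      PainleveOne.etaRoots x₀ = {PainleveOne.eta x₀} ∧
      -- the three infima are finite
      PainleveOne.extXmin x₀ = (PainleveOne.Xmin x₀ : EReal) ∧
      PainleveOne.extXminus x₀ = (PainleveOne.Xminus x₀ : EReal) ∧
      PainleveOne.extX x₀ = (PainleveOne.X x₀ : EReal) ∧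
      -- two-sided bounds for `x₀ ≤ 0`
      PainleveOne.Xminus (PainleveOne.Xmin x₀) ≤ PainleveOne.X x₀ ∧
      PainleveOne.X x₀ < x₀ - (2 : ℝ) ^ (4 / 5 : ℝ) * PainleveOne.C /
        PainleveOne.eta (x₀ / (2 : ℝ) ^ (4 / 5 : ℝ))) ∧
    -- two-sided bounds for `x₀ < 0`
    (∀ x₀ : ℝ, x₀ < 0 →
      x₀ - PainleveOne.C / |x₀| ^ (1 / 4 : ℝ) - PainleveOne.C / PainleveOne.eta x₀ <
        PainleveOne.Xmin x₀ - PainleveOne.C / |PainleveOne.Xmin x₀| ^ (1 / 4 : ℝ) ∧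
      PainleveOne.Xmin x₀ - PainleveOne.C / |PainleveOne.Xmin x₀| ^ (1 / 4 : ℝ) <
        PainleveOne.X x₀ ∧
      PainleveOne.X x₀ < x₀ - (2 : ℝ) ^ (4 / 5 : ℝ) * PainleveOne.C /
        |PainleveOne.Xmin (x₀ / (2 : ℝ) ^ (4 / 5 : ℝ))| ^ (1 / 4 : ℝ) ∧
      x₀ - (2 : ℝ) ^ (4 / 5 : ℝ) * PainleveOne.C /
          |PainleveOne.Xmin (x₀ / (2 : ℝ) ^ (4 / 5 : ℝ))| ^ (1 / 4 : ℝ) <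
        x₀ - 2 * PainleveOne.C /
          |(|x₀| + 2 * PainleveOne.C / |x₀| ^ (1 / 4 : ℝ))| ^ (1 / 4 : ℝ)) ∧
    -- asymptotics as `x₀ → -∞`
    (fun x₀ : ℝ => PainleveOne.X x₀ - (x₀ - 2 * PainleveOne.C / |x₀| ^ (1 / 4 : ℝ)))
      =O[Filter.atBot] (fun x₀ : ℝ => 1 / |x₀| ^ (3 / 2 : ℝ)) ∧
    -- explicit bound on the error term
    (∀ x₀ : ℝ, x₀ ≤ 0 → (2 * PainleveOne.C) ^ (4 / 5 : ℝ) < |x₀| →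
      0 < PainleveOne.X x₀ - (x₀ - 2 * PainleveOne.C / |x₀| ^ (1 / 4 : ℝ)) ∧
      PainleveOne.X x₀ - (x₀ - 2 * PainleveOne.C / |x₀| ^ (1 / 4 : ℝ)) <
        PainleveOne.C ^ 2 / |x₀| ^ (3 / 2 : ℝ)) := by
  refine ⟨PainleveOne.isGreatest_C, fun x₀ hx₀ => ⟨PainleveOne.etaRoots_eq x₀,
    PainleveOne.extXmin_eq hx₀, PainleveOne.extXminus_eq hx₀, PainleveOne.extX_eq hx₀,
    PainleveOne.Xminus_Xmin_le_X hx₀, PainleveOne.X_lt_eta hx₀⟩,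
    fun x₀ hx₀ => ⟨PainleveOne.lt_Xmin_sub hx₀, PainleveOne.Xmin_sub_lt_X hx₀,
      PainleveOne.X_lt_Xmin hx₀, PainleveOne.two_mul_C_div_lt hx₀⟩,
    PainleveOne.isBigO_error, fun x₀ hx₀ hlarge => ?_⟩
  -- The lower bound on |x₀| excludes x₀ = 0; both error estimates hold at every negative x₀.
  have hneg : x₀ < 0 := by
    refine lt_of_le_of_ne hx₀ fun h => ?_
    rw [h, abs_zero] at hlarge
    exact absurd hlarge (not_lt.2 (Real.rpow_nonneg (mul_pos two_pos PainleveOne.C_pos).le _))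
  exact ⟨PainleveOne.error_pos hneg, PainleveOne.error_lt hneg⟩
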